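/- Spaces are over $\mathbb{K}=\mathbb{R}$ or $\mathbb{C}$ and operators are bounded and linear. For Banach spaces $X,Y$, $[\mathcal{G}_{\ell_2}](X,Y)$ denotes the closed linear span in $\mathcal{L}(X,Y)$ of the operators that factor through $\ell_2$. An operator $T\in\mathcal{L}(X,Y)$ is finitely strictly singular, $T\in\mathcal{FSS}(X,Y)$, if for every $\varepsilon>0$ there is $n\ge 1$ such that every $n$-dimensional subspace $E\subseteq X$ contains a vector $x$ with $\|Tx\|<\varepsilon\|x\|$. It is superstrictly cosingular, $T\in\mathcal{SSCS}(X,Y)$, if $a_n(T)\to 0$ as $n\to\infty$, where $a_n(T)$ is the supremum of all $r\ge 0$ for which there is a closed subspace $E\subseteq Y$ with $\dim(Y/E)=n$ such that the image of the closed unit ball of $X$ under $X\xrightarrow{T}Y\to Y/E$ contains the closed ball of radius $r$ of $Y/E$. **Theorem.** Let $1<p<2$ and $\frac1p+\frac1{p'}=1$. Let $X$ be a Banach space containing a complemented copy of $\ell_p$, with projection $P$ onto it; that is, $P\in\mathcal{L}(X,\ell_p)$ and there is $Q\in\mathcal{L}(\ell_p,X)$ with $PQ=\mathrm{id}_{\ell_p}$.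 Let $Y$ be a Banach space. (i) Suppose that $J:c_0\to Y$ is an isomorphic embedding (bounded, linear and bounded below). Then there is an operator $U\in(\mathcal{FSS}\cap\mathcal{SSCS})(\ell_p,c_0)$ such that $JUP\notin[\mathcal{G}_{\ell_2}](X,Y)$. If moreover $X$ is reflexive, then there is an operator $V\in(\mathcal{FSS}\cap\mathcal{SSCS})(Y^*,X^*)$ with $V\notin[\mathcal{G}_{\ell_2}](Y^*,X^*)$. (ii) Let $p'\le q<\infty$ and suppose that $J:\ell_q\to Y$ is an isomorphic embedding. Then there is an operator $U\in(\mathcal{FSS}\cap\mathcal{SSCS})(\ell_p,\ell_q)$ such that $JUP\notin[\mathcal{G}_{\ell_2}](X,Y)$. If moreover $X$ is reflexive, then there is an operator $V\in(\mathcal{FSS}\cap\mathcal{SSCS})(Y^*,X^*)$ with $V\notin[\mathcal{G}_{\ell_2}](Y^*,X^*)$. In both parts, $U$ can be taken to be the operator whose matrix with respect to the canonical bases is block diagonal with consecutive blocks $2^{-n/p'}H_n$, $n=0,1,2,\dots$, where $H_n$ is the $2^n\times 2^n$ Hadamard matrix defined by $H_0=[1]$ and $H_{n+1}=\begin{bmatrix}H_n&H_n\\H_n&-H_n\end{bmatrix}$.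 -/

import Mathlib

open scoped ENNReal NNReal Topology

noncomputable section

/-- The sequence space `ℓ_p` of scalar sequences indexed by `ℕ`. -/
abbrev Ell (𝕜 : Type*) [RCLike 𝕜] (p : ℝ≥0∞) : Type _ := lp (fun _ : ℕ => 𝕜) p

/-- The space `c₀` of scalar sequences tending to zero (`ℕ` is discrete), with the sup norm. -/
abbrev CZero (𝕜 : Type*) [RCLike 𝕜] : Type _ := ZeroAtInftyContinuousMap ℕ 𝕜

section OperatorClasses

variable {𝕜 : Type*} [RCLike 𝕜]
  {X : Type*} [NormedAddCommGroup X] [NormedSpace 𝕜 X]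
  {Y : Type*} [NormedAddCommGroup Y] [NormedSpace 𝕜 Y]

/-- Finitely strictly singular operators: for every `ε > 0` there is a positive integer `n` such
that every `n`-dimensional subspace contains a vector `x` with `‖T x‖ < ε ‖x‖`
(such an `x` is automatically nonzero). -/
def IsFSS (T : X →L[𝕜] Y) : Prop :=
  ∀ ε : ℝ, 0 < ε → ∃ n : ℕ, 1 ≤ n ∧
    ∀ E : Submodule 𝕜 X, Module.finrank 𝕜 E = n → ∃ x ∈ E, ‖T x‖ < ε * ‖x‖

/-- The surjection modulus of an operator followed by the quotient map `Y → Y ⧸ E`: the supremum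
of all `r ≥ 0` such that the image of the closed unit ball of `X` in `Y ⧸ E` contains the
closed ball of radius `r`. -/
def surjModulus (T : X →L[𝕜] Y) (E : Submodule 𝕜 Y) : ℝ≥0∞ :=
  ⨆ (r : ℝ≥0) (_ : Metric.closedBall (0 : Y ⧸ E) (r : ℝ) ⊆
      (fun x : X => (Submodule.Quotient.mk (T x) : Y ⧸ E)) '' Metric.closedBall (0 : X) 1),
    (r : ℝ≥0∞)

/-- `a_n(T)`: the supremum of the surjection moduli of `X → Y → Y ⧸ E` over all closed
subspaces `E` of `Y` with `dim (Y ⧸ E) = n`.  (It is only used for large `n`; for `n ≥ 1` the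
condition forces `Y ⧸ E` to be finite-dimensional.) -/
def cosingularNumber (T : X →L[𝕜] Y) (n : ℕ) : ℝ≥0∞ :=
  ⨆ (E : Submodule 𝕜 Y) (_ : IsClosed (E : Set Y)) (_ : Module.finrank 𝕜 (Y ⧸ E) = n),
    surjModulus T E

/-- Superstrictly cosingular operators: `a_n(T) → 0`. -/
def IsSSCS (T : X →L[𝕜] Y) : Prop :=
  Filter.Tendsto (cosingularNumber T) Filter.atTop (𝓝 0)

end OperatorClasses

/-- The set of operators `X → Y` that factor through `Z`. -/
def factorsThrough (𝕜 : Type*) [RCLike 𝕜]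
    (Z : Type*) [NormedAddCommGroup Z] [NormedSpace 𝕜 Z]
    (X : Type*) [NormedAddCommGroup X] [NormedSpace 𝕜 X]
    (Y : Type*) [NormedAddCommGroup Y] [NormedSpace 𝕜 Y] : Set (X →L[𝕜] Y) :=
  {T | ∃ (A : Z →L[𝕜] Y) (B : X →L[𝕜] Z), T = A.comp B}

/-- `[𝒢_{ℓ₂}](X, Y)`: the closed linear span of the operators `X → Y` that factor
through `ℓ₂`. -/
def closedSpanG2 (𝕜 : Type*) [RCLike 𝕜]
    (X : Type*) [NormedAddCommGroup X] [NormedSpace 𝕜 X]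
    (Y : Type*) [NormedAddCommGroup Y] [NormedSpace 𝕜 Y] : Submodule 𝕜 (X →L[𝕜] Y) :=
  (Submodule.span 𝕜 (factorsThrough 𝕜 (Ell 𝕜 2) X Y)).topologicalClosure

/-- A normed space is reflexive if the canonical map into its bidual is onto. -/
def IsReflexiveSpace (𝕜 : Type*) [RCLike 𝕜]
    (X : Type*) [NormedAddCommGroup X] [NormedSpace 𝕜 X] : Prop :=
  Function.Surjective (NormedSpace.inclusionInDoubleDual 𝕜 X)

/-- The entries, for `i, j < 2 ^ n`, of the `2 ^ n × 2 ^ n` Hadamard matrix defined by `H₀ = [1]`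
and by letting the next matrix have the blocks `H, H` in the first row and `H, -H` in the
second. -/
def hadamardEntry : ℕ → ℕ → ℕ → ℝ
  | 0, _, _ => 1
  | n + 1, i, j =>
      (if 2 ^ n ≤ i ∧ 2 ^ n ≤ j then -1 else 1) * hadamardEntry n (i % 2 ^ n) (j % 2 ^ n)

/-- The entries of the infinite block diagonal matrix whose `n`-th diagonal block (`n ≥ 0`) is
`2 ^ (-n / s)` times the `2 ^ n × 2 ^ n` Hadamard matrix.  The blocks are placed one after the
other, so that block `n` occupies the indices `i` with `2 ^ n ≤ i + 1 < 2 ^ (n + 1)`. -/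
def hadamardSumEntry (s : ℝ) (i j : ℕ) : ℝ :=
  if Nat.log 2 (i + 1) = Nat.log 2 (j + 1) then
    (2 : ℝ) ^ (-(Nat.log 2 (j + 1) : ℝ) / s) *
      hadamardEntry (Nat.log 2 (j + 1))
        (i + 1 - 2 ^ Nat.log 2 (j + 1)) (j + 1 - 2 ^ Nat.log 2 (j + 1))
  else 0

end

/-! ### Hadamard matrices -/

/-! Write N = 2^n. The matrix N^(-1/2) Hₙ is orthogonal and Hₙ has entries ±1, so interpolation
between ℓ_1 → ℓ_∞ and ℓ_2 → ℓ_2 makes the block diagonal matrix with blocks N^(-1/p') Hₙ a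
contraction H : ℓ_p → ℓ_p'. U is H followed by the formal inclusion into c₀ or ℓ_q.

H is finitely strictly singular because the interpolation gains on spread-out data.
`hausdorff_young_hadamard` treats Hilbert-space valued sequences and keeps track of a constant L
from the ℓ_1 → ℓ_∞ end. An n-dimensional subspace E of ℓ_p contains a family y_i, obtained from an
almost maximal determinant (a weak form of Lewis's basis, `exists_well_conditioned_family`), for
which L = 2/√n. The square function of (y_i) then has energy 1, but that of (H y_i) has energy at
most (2/√n)^(p'-2). Khintchine's inequalities turn both into averages over signs, and for large n
these exclude ‖Hx‖ ≥ ε‖x‖ on all of E (`isFSS_hadamardOp`).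

Cosingularity comes from duality: T is superstrictly cosingular once T* is finitely strictly
singular (`IsFSS.isSSCS_of_dualOp`). Since the matrix is symmetric, H* is dominated by H itself. V
is the adjoint of JUP; when X is reflexive, V* is dominated by JUP.

To leave the closed span, pair operators with Hₙ (`hadamardForm`). The pairing is at most a constant
times N^(1+1/p) ‖T‖ for every T, has modulus N² · N^(-1/p') = N^(1+1/p) at JUP, and is O(N^(3/2)) on
operators through ℓ₂ by orthogonality. As p < 2, 3/2 < 1 + 1/p, so the normalised pairings tend to 0
on the span and, being uniformly bounded, on its closure. The same test applies to V with vectors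
and functionals exchanged. -/

theorem hadamardEntry_comm (n i j : ℕ) : hadamardEntry n i j = hadamardEntry n j i := by
  induction n generalizing i j with
  | zero => rfl
  | succ n ih => simp only [hadamardEntry, ih (i % 2 ^ n), and_comm]

theorem abs_hadamardEntry (n i j : ℕ) : |hadamardEntry n i j| = 1 := by
  induction n generalizing i j with
  | zero => simp [hadamardEntry]
  | succ n ih =>
    simp only [hadamardEntry, abs_mul, ih, mul_one]
    split_ifs <;> simp

theorem sum_hadamardEntry_mul (n : ℕ) {j l : ℕ} (hj : j < 2 ^ n) (hl : l < 2 ^ n) :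
    ∑ t ∈ Finset.range (2 ^ n), hadamardEntry n t j * hadamardEntry n t l =
      if j = l then 2 ^ n else 0 := by
  induction n generalizing j l with
  | zero =>
    have : j = l := by omega
    simp [hadamardEntry, this]
  | succ n ih =>
    have hpos : 0 < 2 ^ n := by positivity
    have key : ∀ a < 2 ^ (n + 1), ∀ t < 2 ^ n,
        hadamardEntry (n + 1) t a = hadamardEntry n t (a % 2 ^ n) ∧
        hadamardEntry (n + 1) (2 ^ n + t) a =
          (if 2 ^ n ≤ a then -1 else 1) * hadamardEntry n t (a % 2 ^ n) := by
      intro a _ t ht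
      have h1 : ¬ (2 ^ n ≤ t ∧ 2 ^ n ≤ a) := by omega
      have h2 : (2 ^ n ≤ 2 ^ n + t ∧ 2 ^ n ≤ a) ↔ 2 ^ n ≤ a := by omega
      simp only [hadamardEntry, h1, h2, if_false, Nat.mod_eq_of_lt ht, one_mul,
        Nat.add_mod_left, and_self]
    rw [pow_succ, mul_two, Finset.sum_range_add, ← Finset.sum_add_distrib]
    have h3 : ∀ t ∈ Finset.range (2 ^ n),
        hadamardEntry (n + 1) t j * hadamardEntry (n + 1) t l +
          hadamardEntry (n + 1) (2 ^ n + t) j * hadamardEntry (n + 1) (2 ^ n + t) l =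
        (1 + (if 2 ^ n ≤ j then -1 else 1) * (if 2 ^ n ≤ l then -1 else 1)) *
          (hadamardEntry n t (j % 2 ^ n) * hadamardEntry n t (l % 2 ^ n)) := by
      intro t ht
      have ht' := Finset.mem_range.1 ht
      rw [(key j hj t ht').1, (key j hj t ht').2, (key l hl t ht').1, (key l hl t ht').2]
      ring
    rw [Finset.sum_congr rfl h3, ← Finset.mul_sum,
      ih (Nat.mod_lt _ hpos) (Nat.mod_lt _ hpos)]
    have hmod : ∀ a < 2 ^ (n + 1), a % 2 ^ n = if 2 ^ n ≤ a then a - 2 ^ n else a := by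
      intro a ha
      split_ifs with h
      · rw [Nat.mod_eq_sub_mod h, Nat.mod_eq_of_lt]; rw [pow_succ] at ha; omega
      · exact Nat.mod_eq_of_lt (by omega)
    rw [hmod j hj, hmod l hl]
    rw [pow_succ] at hj hl
    by_cases h1 : 2 ^ n ≤ j <;> by_cases h2 : 2 ^ n ≤ l <;> simp only [h1, h2, if_true, if_false]
    · by_cases h : j = l
      · simp [h]; ring
      · rw [if_neg (by omega), if_neg h]; ring
    · rw [if_neg (show j ≠ l by omega)]; ring
    · rw [if_neg (show j ≠ l by omega)]; ring
    · by_cases h : j = l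
      · simp [h]; ring
      · rw [if_neg h, if_neg h]; ring

/-- The index of the diagonal block that contains `i`. -/
def blockIndex (i : ℕ) : ℕ := Nat.log 2 (i + 1)

theorem blockIndex_eq_iff {i k : ℕ} : blockIndex i = k ↔ 2 ^ k ≤ i + 1 ∧ i + 1 < 2 ^ (k + 1) :=
  Nat.log_eq_iff (Or.inr ⟨by norm_num, by omega⟩)

theorem blockIndex_block {n t : ℕ} (ht : t < 2 ^ n) : blockIndex (2 ^ n - 1 + t) = n := by
  have := Nat.one_le_two_pow (n := n)
  rw [blockIndex_eq_iff, pow_succ]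
  omega

theorem blockIndex_lt {j K : ℕ} (hj : j < 2 ^ K - 1) : blockIndex j < K :=
  Nat.log_lt_of_lt_pow (by omega) (by omega)

/-- The block diagonal sign matrix whose blocks are the Hadamard matrices. -/
noncomputable def hadamardSign (i j : ℕ) : ℝ :=
  if blockIndex i = blockIndex j then
    hadamardEntry (blockIndex j) (i + 1 - 2 ^ blockIndex j) (j + 1 - 2 ^ blockIndex j)
  else 0

theorem hadamardSumEntry_eq (s : ℝ) (i j : ℕ) :
    hadamardSumEntry s i j = (2 : ℝ) ^ (-(blockIndex j : ℝ) / s) * hadamardSign i j := by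
  simp only [hadamardSumEntry, hadamardSign, blockIndex]
  split_ifs with h <;> simp [h]

theorem hadamardSign_comm (i j : ℕ) : hadamardSign i j = hadamardSign j i := by
  unfold hadamardSign
  by_cases h : blockIndex i = blockIndex j
  · rw [if_pos h, if_pos h.symm, hadamardEntry_comm, h]
  · rw [if_neg h, if_neg (Ne.symm h)]

theorem hadamardSumEntry_comm (s : ℝ) (i j : ℕ) :
    hadamardSumEntry s i j = hadamardSumEntry s j i := by
  rw [hadamardSumEntry_eq, hadamardSumEntry_eq, hadamardSign_comm i j]
  by_cases h : blockIndex i = blockIndex j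
  · rw [h]
  · simp [hadamardSign, Ne.symm h]

theorem abs_hadamardSign_le (i j : ℕ) : |hadamardSign i j| ≤ 1 := by
  unfold hadamardSign
  split_ifs
  · rw [abs_hadamardEntry]
  · simp

/-- Block k is the interval from 2^k - 1 to 2(2^k - 1), so an index is at most twice any other index
of its block. Rows and columns are therefore finitely supported, with an explicit bound. -/
theorem hadamardSign_ne_zero {i j : ℕ} (h : hadamardSign i j ≠ 0) : j < 2 * i + 1 := by
  have h1 : blockIndex i = blockIndex j := by
    by_contra hne; exact h (if_neg hne)
  have h2 := (blockIndex_eq_iff (i := i)).1 h1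
  have h3 := (blockIndex_eq_iff (i := j)).1 rfl
  rw [pow_succ] at h3
  omega

theorem hadamardSign_block (n : ℕ) {t j : ℕ} (ht : t < 2 ^ n) (hj : j < 2 ^ n) :
    hadamardSign (2 ^ n - 1 + t) (2 ^ n - 1 + j) = hadamardEntry n t j := by
  have := Nat.one_le_two_pow (n := n)
  rw [hadamardSign, blockIndex_block ht, blockIndex_block hj, if_pos rfl]
  congr 1 <;> omega

/-- The first 2^K - 1 indices are exactly the first K blocks, so truncating there cuts no block.
Only rows in the block of j contribute, and there the orthogonality of the Hadamard matrix applies.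
-/
theorem sum_hadamardSign_mul {K j l : ℕ} (hj : j < 2 ^ K - 1) :
    ∑ i ∈ Finset.range (2 ^ K - 1), hadamardSign i j * hadamardSign i l =
      if j = l then 2 ^ blockIndex j else 0 := by
  by_cases hb : blockIndex j = blockIndex l
  · set k := blockIndex j with hk
    clear_value k
    have hkK : k < K := hk ▸ blockIndex_lt hj
    have hpow : 2 ^ (k + 1) ≤ 2 ^ K := Nat.pow_le_pow_right (by norm_num) hkK
    have hjk := (blockIndex_eq_iff (i := j)).1 hk.symm
    have hlk := (blockIndex_eq_iff (i := l)).1 hb.symm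
    have h1 := Nat.one_le_two_pow (n := k)
    have hsub : Finset.Ico (2 ^ k - 1) (2 ^ (k + 1) - 1) ⊆ Finset.range (2 ^ K - 1) := by
      intro i; simp only [Finset.mem_Ico, Finset.mem_range]; omega
    rw [← Finset.sum_subset hsub, Finset.sum_Ico_eq_sum_range]
    · have hN : 2 ^ (k + 1) - 1 - (2 ^ k - 1) = 2 ^ k := by rw [pow_succ]; omega
      rw [pow_succ] at hjk hlk
      obtain ⟨a, rfl⟩ : ∃ a, j = 2 ^ k - 1 + a := ⟨j - (2 ^ k - 1), by omega⟩
      obtain ⟨b, rfl⟩ : ∃ b, l = 2 ^ k - 1 + b := ⟨l - (2 ^ k - 1), by omega⟩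
      rw [hN]
      have h2 : ∀ t ∈ Finset.range (2 ^ k),
          hadamardSign (2 ^ k - 1 + t) (2 ^ k - 1 + a) *
            hadamardSign (2 ^ k - 1 + t) (2 ^ k - 1 + b) =
          hadamardEntry k t a * hadamardEntry k t b := by
        intro t ht
        rw [hadamardSign_block k (Finset.mem_range.1 ht) (by omega),
          hadamardSign_block k (Finset.mem_range.1 ht) (by omega)]
      rw [Finset.sum_congr rfl h2, sum_hadamardEntry_mul k (by omega) (by omega)]
      simp
    · intro i _ hi
      have : blockIndex i ≠ k := by
        intro h
        have := (blockIndex_eq_iff (i := i)).1 h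
        apply hi
        simp only [Finset.mem_Ico]
        omega
      simp [hadamardSign, ← hk, this]
  · rw [if_neg (fun h => hb (by rw [h]))]
    refine Finset.sum_eq_zero fun i _ => ?_
    by_cases h : blockIndex i = blockIndex j
    · simp [hadamardSign, h, hb]
    · simp [hadamardSign, h]

/-! ### A vector-valued Hausdorff–Young inequality for Hadamard matrices -/

theorem sum_norm_sq_smul_of_orthogonal {H : Type*} [NormedAddCommGroup H]
    [InnerProductSpace ℝ H] (s : Finset ℕ) (m : ℕ → ℕ → ℝ) (w : ℕ → ℝ)
    (hm : ∀ j ∈ s, ∀ l ∈ s, ∑ t ∈ s, m t j * m t l = if j = l then w j else 0) (v : ℕ → H) :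
    ∑ t ∈ s, ‖∑ j ∈ s, m t j • v j‖ ^ 2 = ∑ j ∈ s, w j * ‖v j‖ ^ 2 := by
  have h1 : ∀ t, ‖∑ j ∈ s, m t j • v j‖ ^ 2 =
      ∑ j ∈ s, ∑ l ∈ s, m t j * m t l * inner ℝ (v j) (v l) := by
    intro t
    rw [← real_inner_self_eq_norm_sq, sum_inner]
    refine Finset.sum_congr rfl fun j _ => ?_
    rw [inner_sum]
    refine Finset.sum_congr rfl fun l _ => ?_
    rw [real_inner_smul_left, real_inner_smul_right, mul_assoc]
  simp_rw [h1]
  rw [Finset.sum_comm]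
  refine Finset.sum_congr rfl fun j hj => ?_
  rw [Finset.sum_comm]
  simp_rw [← Finset.sum_mul]
  rw [Finset.sum_eq_single j]
  · rw [hm j hj j hj, if_pos rfl, real_inner_self_eq_norm_sq]
  · intro l hl hlj
    rw [hm j hj l hl, if_neg (Ne.symm hlj), zero_mul]
  · intro h; exact absurd hj h

theorem sum_norm_sq_hadamardSign_smul {H : Type*} [NormedAddCommGroup H] [InnerProductSpace ℝ H]
    (K : ℕ) (v : ℕ → H) :
    ∑ t ∈ Finset.range (2 ^ K - 1),
        ‖∑ j ∈ Finset.range (2 ^ K - 1), hadamardSign t j • v j‖ ^ 2 =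
      ∑ j ∈ Finset.range (2 ^ K - 1), 2 ^ blockIndex j * ‖v j‖ ^ 2 :=
  sum_norm_sq_smul_of_orthogonal _ _ _
    (fun _ hj _ _ => sum_hadamardSign_mul (Finset.mem_range.1 hj)) v

/-- The ℓ_2 → ℓ_2 end of the interpolation. The unimodular `ζ`, `η` absorb the imaginary powers that
occur on the line Re z = 1. -/
theorem norm_sum_hadamardSign_mul_inner_le {H : Type*} [NormedAddCommGroup H]
    [InnerProductSpace ℝ H] (K : ℕ) (g b : ℕ → H) (ζ η : ℕ → ℂ) (hζ : ∀ t, ‖ζ t‖ = 1)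
    (hη : ∀ j, ‖η j‖ = 1) :
    ‖∑ t ∈ Finset.range (2 ^ K - 1), ∑ j ∈ Finset.range (2 ^ K - 1),
        ((hadamardSign t j * (2 : ℝ) ^ (-(blockIndex j : ℝ) / 2) * inner ℝ (g t) (b j) : ℝ) : ℂ) *
          (ζ t * η j)‖ ≤
      √(∑ t ∈ Finset.range (2 ^ K - 1), ‖g t‖ ^ 2) *
        √(∑ j ∈ Finset.range (2 ^ K - 1), ‖b j‖ ^ 2) := by
  set s := Finset.range (2 ^ K - 1)
  let a : ℕ → ℝ := fun j => (2 : ℝ) ^ (-(blockIndex j : ℝ) / 2)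
  let w : (ℕ → ℝ) → ℕ → H := fun e t => ∑ j ∈ s, hadamardSign t j • ((a j * e j) • b j)
  have hinner : ∀ e t, inner ℝ (g t) (w e t) =
      ∑ j ∈ s, hadamardSign t j * a j * inner ℝ (g t) (b j) * e j := by
    intro e t
    simp only [w]
    rw [inner_sum]
    refine Finset.sum_congr rfl fun j _ => ?_
    rw [real_inner_smul_right, real_inner_smul_right]; ring
  have hw : ∀ e : ℕ → ℝ, ∑ t ∈ s, ‖w e t‖ ^ 2 = ∑ j ∈ s, (e j) ^ 2 * ‖b j‖ ^ 2 := by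
    intro e
    rw [sum_norm_sq_hadamardSign_smul]
    refine Finset.sum_congr rfl fun j _ => ?_
    have ha : (2 : ℝ) ^ blockIndex j * a j ^ 2 = 1 := by
      simp only [a]
      rw [← Real.rpow_natCast, ← Real.rpow_natCast, ← Real.rpow_mul (by norm_num),
        ← Real.rpow_add (by norm_num)]
      norm_num
    rw [norm_smul, mul_pow, Real.norm_eq_abs, sq_abs, mul_pow]
    linear_combination (e j ^ 2 * ‖b j‖ ^ 2) * ha
  have hterm : ∀ t ∈ s, ‖∑ j ∈ s, ((hadamardSign t j * a j * inner ℝ (g t) (b j) : ℝ) : ℂ) *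
      (ζ t * η j)‖ ≤ ‖g t‖ *
        √(‖w (fun j => (η j).re) t‖ ^ 2 + ‖w (fun j => (η j).im) t‖ ^ 2) := by
    intro t _
    -- `H` is only a real space, so the complex phases `η` are split into real and imaginary parts.
    -- The two pieces recombine at the end through re² + im² = 1.
    have h1 : ∑ j ∈ s, ((hadamardSign t j * a j * inner ℝ (g t) (b j) : ℝ) : ℂ) * (ζ t * η j) =
        ζ t * ((inner ℝ (g t) (w (fun j => (η j).re) t) : ℝ) +
          (inner ℝ (g t) (w (fun j => (η j).im) t) : ℝ) * Complex.I) := by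
      rw [hinner, hinner]
      push_cast
      rw [Finset.sum_mul, ← Finset.sum_add_distrib, Finset.mul_sum]
      refine Finset.sum_congr rfl fun j _ => ?_
      conv_lhs => rw [← Complex.re_add_im (η j)]
      ring
    rw [h1, norm_mul, hζ, one_mul, Complex.norm_add_mul_I]
    rw [← Real.sqrt_sq (norm_nonneg (g t)), ← Real.sqrt_mul (sq_nonneg _)]
    apply Real.sqrt_le_sqrt
    have h2 := abs_real_inner_le_norm (g t) (w (fun j => (η j).re) t)
    have h3 := abs_real_inner_le_norm (g t) (w (fun j => (η j).im) t)
    have h4 := sq_le_sq' (by linarith [abs_nonneg (inner ℝ (g t) (w (fun j => (η j).re) t))]) h2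
    have h5 := sq_le_sq' (by linarith [abs_nonneg (inner ℝ (g t) (w (fun j => (η j).im) t))]) h3
    rw [sq_abs] at h4 h5
    nlinarith
  refine (norm_sum_le _ _).trans ((Finset.sum_le_sum hterm).trans ?_)
  refine (Real.sum_mul_le_sqrt_mul_sqrt _ _ _).trans_eq ?_
  congr 2
  have h6 : ∀ t ∈ s, √(‖w (fun j => (η j).re) t‖ ^ 2 + ‖w (fun j => (η j).im) t‖ ^ 2) ^ 2 =
      ‖w (fun j => (η j).re) t‖ ^ 2 + ‖w (fun j => (η j).im) t‖ ^ 2 := fun t _ =>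
    Real.sq_sqrt (by positivity)
  rw [Finset.sum_congr rfl h6, Finset.sum_add_distrib, hw, hw, ← Finset.sum_add_distrib]
  refine Finset.sum_congr rfl fun j _ => ?_
  have h7 := Complex.sq_norm (η j)
  rw [hη, Complex.normSq_apply] at h7
  rw [← add_mul]
  nlinarith

/-- Three lines theorem: a finite exponential sum with real frequencies is entire and bounded on the
strip 0 ≤ Re z ≤ 1. -/
theorem norm_sum_exp_le_interp {κ : Type*} (s : Finset κ) (c μ l : κ → ℝ) {A B θ : ℝ}
    (hθ0 : 0 ≤ θ) (hθ1 : θ ≤ 1)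
    (h0 : ∀ y : ℝ, ‖∑ k ∈ s, (c k : ℂ) * Complex.exp (μ k + l k * (y * Complex.I))‖ ≤ A)
    (h1 : ∀ y : ℝ, ‖∑ k ∈ s, (c k : ℂ) * Complex.exp (μ k + l k * (1 + y * Complex.I))‖ ≤ B) :
    |∑ k ∈ s, c k * Real.exp (μ k + l k * θ)| ≤ A ^ (1 - θ) * B ^ θ := by
  let f : ℂ → ℂ := fun z => ∑ k ∈ s, (c k : ℂ) * Complex.exp (μ k + l k * z)
  have hf : f θ = ((∑ k ∈ s, c k * Real.exp (μ k + l k * θ) : ℝ) : ℂ) := by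
    simp only [f]; push_cast; rfl
  have hd : Differentiable ℂ f := by
    simp only [f]
    fun_prop
  have hB : BddAbove ((norm ∘ f) '' Complex.HadamardThreeLines.verticalClosedStrip 0 1) := by
    refine ⟨∑ k ∈ s, |c k| * Real.exp (|μ k| + |l k|), ?_⟩
    rintro _ ⟨z, hz, rfl⟩
    have hz' : 0 ≤ z.re ∧ z.re ≤ 1 := hz
    refine (norm_sum_le _ _).trans (Finset.sum_le_sum fun k _ => ?_)
    rw [norm_mul, Complex.norm_real, Real.norm_eq_abs, Complex.norm_exp]
    gcongr
    have : (μ k + l k * z : ℂ).re = μ k + l k * z.re := by simp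
    rw [this]
    have h2 : l k * z.re ≤ |l k| := by
      calc l k * z.re ≤ |l k| * z.re := by gcongr; exacts [hz'.1, le_abs_self _]
        _ ≤ |l k| * 1 := by gcongr; exact hz'.2
        _ = _ := mul_one _
    linarith [le_abs_self (μ k)]
  have key := Complex.HadamardThreeLines.norm_le_interp_of_mem_verticalClosedStrip₀₁' f
    (z := (θ : ℂ)) (a := A) (b := B) (by
      simp only [Complex.HadamardThreeLines.verticalClosedStrip, Set.mem_preimage,
        Complex.ofReal_re, Set.mem_Icc]
      exact ⟨hθ0, hθ1⟩) hd.diffContOnCl hB ?_ ?_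
  · rwa [hf, Complex.norm_real, Complex.ofReal_re, Real.norm_eq_abs] at key
  · intro z hz
    have : z = z.im * Complex.I := by
      apply Complex.ext <;> simp; exact hz
    rw [this]; exact h0 _
  · intro z hz
    have : z = 1 + z.im * Complex.I := by
      apply Complex.ext <;> simp; exact hz
    rw [this]; exact h1 _

/-- `Real.log 0 = 0` makes the exponential 1 at x = 0, where it need not agree with the power; a
coefficient that vanishes there repairs the identity. -/
theorem mul_exp_mul_log {x : ℝ} (hx : 0 ≤ x) {a : ℝ} (y : ℝ) (h : x = 0 → a = 0) :
    a * Real.exp (y * Real.log x) = a * x ^ y := by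
  rcases hx.eq_or_lt with h0 | h0
  · simp [h h0.symm]
  · rw [Real.rpow_def_of_pos h0, mul_comm y]

/-- Stein interpolation of the bilinear form. At Re z = 0 the matrix entries are bounded by 1 and
the hypothesis on `L` applies; at Re z = 1 the normalised matrix is orthogonal. -/
theorem hausdorff_young_bilinear {H : Type*} [NormedAddCommGroup H] [InnerProductSpace ℝ H]
    (K : ℕ) {p p' : ℝ} (hpp' : p.HolderConjugate p') (hp2 : p < 2) (g b : ℕ → H) {L : ℝ}
    (hL : ∀ h : H, ∑ j ∈ Finset.range (2 ^ K - 1), |inner ℝ h (b j)| * ‖b j‖ ^ (p - 1) ≤ L * ‖h‖) :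
    |∑ t ∈ Finset.range (2 ^ K - 1), inner ℝ (g t)
        (∑ j ∈ Finset.range (2 ^ K - 1), hadamardSumEntry p' t j • b j)| ≤
      (L * ∑ t ∈ Finset.range (2 ^ K - 1), ‖g t‖ ^ p) ^ (1 - 2 / p') *
        (√(∑ t ∈ Finset.range (2 ^ K - 1), ‖g t‖ ^ p) *
          √(∑ j ∈ Finset.range (2 ^ K - 1), ‖b j‖ ^ p)) ^ (2 / p') := by
  set s := Finset.range (2 ^ K - 1)
  have hp1 : 1 < p := hpp'.lt
  have hp0 : 0 < p := hpp'.pos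
  have hp'0 : 0 < p' := hpp'.symm.pos
  have hmul : p * p' = p + p' := hpp'.mul_eq_add
  have hp'2 : 2 < p' := by nlinarith [hpp'.symm.lt]
  let c : ℕ × ℕ → ℝ := fun k => hadamardSign k.1 k.2 * inner ℝ (g k.1) (b k.2)
  let lg : ℕ × ℕ → ℝ := fun k => Real.log ‖b k.2‖ + Real.log ‖g k.1‖
  -- The norms ‖b j‖ and ‖g t‖ carry the exponent p - 1 at z = 0 and p/2 - 1 at z = 1. At z = 2/p'
  -- the exponent is p - 1 - p/p' = 0, and the block factor is 2^(-k/p').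
  let μ : ℕ × ℕ → ℝ := fun k => (p - 1) * lg k
  let l : ℕ × ℕ → ℝ := fun k => -(blockIndex k.2 : ℝ) / 2 * Real.log 2 - p / 2 * lg k
  have hc : ∀ k, ∀ y : ℝ, c k * Real.exp (y * lg k) = c k * (‖b k.2‖ ^ y * ‖g k.1‖ ^ y) := by
    intro k y
    simp only [lg]
    rw [mul_add, Real.exp_add, ← mul_assoc, mul_exp_mul_log (norm_nonneg _), mul_right_comm,
      mul_exp_mul_log (norm_nonneg _)]
    · ring
    · intro h; simp [c, norm_eq_zero.1 h]
    · intro h; simp [c, norm_eq_zero.1 h]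
  have key := norm_sum_exp_le_interp (s ×ˢ s) c μ l (θ := 2 / p')
    (A := L * ∑ t ∈ s, ‖g t‖ ^ p)
    (B := √(∑ t ∈ s, ‖g t‖ ^ p) * √(∑ j ∈ s, ‖b j‖ ^ p)) (by positivity)
    (by rw [div_le_one hp'0]; exact hp'2.le) ?_ ?_
  · refine le_trans (le_of_eq ?_) key
    congr 1
    rw [Finset.sum_product]
    refine Finset.sum_congr rfl fun t _ => ?_
    rw [inner_sum]
    refine Finset.sum_congr rfl fun j _ => ?_
    have h1 : μ (t, j) + l (t, j) * (2 / p') = Real.log 2 * (-(blockIndex j : ℝ) / p') := by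
      simp only [μ, l]
      field_simp
      linear_combination lg (t, j) * hmul
    rw [h1, ← Real.rpow_def_of_pos two_pos, real_inner_smul_right, hadamardSumEntry_eq]
    simp only [c]; ring
  · intro y
    have h1 : ∀ k ∈ s ×ˢ s, ‖(c k : ℂ) * Complex.exp (μ k + l k * (y * Complex.I))‖ ≤
        |inner ℝ (g k.1) (b k.2)| * (‖b k.2‖ ^ (p - 1) * ‖g k.1‖ ^ (p - 1)) := by
      intro k _
      have hre : (μ k + l k * (y * Complex.I) : ℂ).re = (p - 1) * lg k := by simp [μ]
      rw [norm_mul, Complex.norm_exp, Complex.norm_real, Real.norm_eq_abs, hre,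
        ← abs_of_pos (Real.exp_pos ((p - 1) * lg k)), ← abs_mul, hc, abs_mul, abs_of_nonneg
        (by positivity : 0 ≤ ‖b k.2‖ ^ (p - 1) * ‖g k.1‖ ^ (p - 1))]
      refine mul_le_mul_of_nonneg_right ?_ (by positivity)
      simp only [c, abs_mul]
      exact mul_le_of_le_one_left (abs_nonneg _) (abs_hadamardSign_le _ _)
    refine (norm_sum_le _ _).trans ((Finset.sum_le_sum h1).trans ?_)
    rw [Finset.sum_product, Finset.mul_sum]
    refine Finset.sum_le_sum fun t _ => ?_
    have h2 : ‖g t‖ ^ p = ‖g t‖ * ‖g t‖ ^ (p - 1) := by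
      rcases (norm_nonneg (g t)).eq_or_lt with h | h
      · rw [← h, Real.zero_rpow hp0.ne']; simp
      · rw [← Real.rpow_one_add' h.le (by linarith)]; ring_nf
    calc ∑ j ∈ s, |inner ℝ (g t) (b j)| * (‖b j‖ ^ (p - 1) * ‖g t‖ ^ (p - 1))
        = (∑ j ∈ s, |inner ℝ (g t) (b j)| * ‖b j‖ ^ (p - 1)) * ‖g t‖ ^ (p - 1) := by
          rw [Finset.sum_mul]; exact Finset.sum_congr rfl fun j _ => by ring
      _ ≤ (L * ‖g t‖) * ‖g t‖ ^ (p - 1) := by gcongr; exact hL _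
      _ = L * ‖g t‖ ^ p := by rw [h2]; ring
  · intro y
    let g' : ℕ → H := fun t => ‖g t‖ ^ (p / 2 - 1) • g t
    let b' : ℕ → H := fun j => ‖b j‖ ^ (p / 2 - 1) • b j
    -- The exponent p/2 - 1 is the one that turns the ℓ_2 sums of the modified vectors into ℓ_p sums
    -- of the original ones.
    have hsq : ∀ v : H, ‖‖v‖ ^ (p / 2 - 1) • v‖ ^ 2 = ‖v‖ ^ p := by
      intro v
      rcases (norm_nonneg v).eq_or_lt with h | h
      · rw [norm_eq_zero.1 h.symm]; simp [Real.zero_rpow hp0.ne']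
      · rw [norm_smul, Real.norm_of_nonneg (by positivity), ← Real.rpow_add_one h.ne',
          ← Real.rpow_natCast, ← Real.rpow_mul h.le]
        congr 1; push_cast; ring
    have h2 := norm_sum_hadamardSign_mul_inner_le K g' b'
      (fun t => Complex.exp (((-(p / 2) * Real.log ‖g t‖ * y : ℝ) : ℂ) * Complex.I))
      (fun j => Complex.exp (((-(blockIndex j : ℝ) / 2 * Real.log 2 * y
        - p / 2 * Real.log ‖b j‖ * y : ℝ) : ℂ) * Complex.I))
      (fun t => Complex.norm_exp_ofReal_mul_I _) (fun j => Complex.norm_exp_ofReal_mul_I _)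
    simp only [g', b', hsq] at h2
    refine le_trans (le_of_eq ?_) h2
    congr 1
    rw [Finset.sum_product]
    refine Finset.sum_congr rfl fun t _ => Finset.sum_congr rfl fun j _ => ?_
    have h3 : (μ (t, j) + l (t, j) * (1 + y * Complex.I) : ℂ) =
        ((Real.log 2 * (-(blockIndex j : ℝ) / 2) : ℝ) : ℂ) + (((p / 2 - 1) * lg (t, j) : ℝ) : ℂ) +
        ((((-(p / 2) * Real.log ‖g t‖ * y : ℝ) : ℂ) * Complex.I) +
        (((-(blockIndex j : ℝ) / 2 * Real.log 2 * y
        - p / 2 * Real.log ‖b j‖ * y : ℝ) : ℂ) * Complex.I)) := by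
      simp only [μ, l, lg]
      push_cast
      ring
    rw [h3, Complex.exp_add, Complex.exp_add (_ * Complex.I), Complex.exp_add, ← mul_assoc]
    congr 1
    rw [← Complex.ofReal_exp, ← Complex.ofReal_exp, ← Real.rpow_def_of_pos two_pos,
      ← Complex.ofReal_mul, ← Complex.ofReal_mul]
    congr 1
    rw [mul_left_comm, hc, real_inner_smul_left, real_inner_smul_right]
    simp only [c]; ring

/-- A Hausdorff–Young inequality for the block diagonal Hadamard matrix acting on vector valued
sequences.  The constant `L` measures how spread out the vectors `b j` are. -/
theorem hausdorff_young_hadamard {H : Type*} [NormedAddCommGroup H] [InnerProductSpace ℝ H]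
    (K : ℕ) {p p' : ℝ} (hpp' : p.HolderConjugate p') (hp2 : p < 2) (b : ℕ → H) {L A : ℝ}
    (hL0 : 0 ≤ L)
    (hL : ∀ h : H, ∑ j ∈ Finset.range (2 ^ K - 1), |inner ℝ h (b j)| * ‖b j‖ ^ (p - 1) ≤ L * ‖h‖)
    (hA : ∑ j ∈ Finset.range (2 ^ K - 1), ‖b j‖ ^ p ≤ A) :
    ∑ t ∈ Finset.range (2 ^ K - 1),
        ‖∑ j ∈ Finset.range (2 ^ K - 1), hadamardSumEntry p' t j • b j‖ ^ p' ≤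
      L ^ (p' - 2) * A := by
  set s := Finset.range (2 ^ K - 1)
  let c : ℕ → H := fun t => ∑ j ∈ s, hadamardSumEntry p' t j • b j
  have hp1 : 1 < p := hpp'.lt
  have hp0 : 0 < p := hpp'.pos
  have hp'0 : 0 < p' := hpp'.symm.pos
  have hmul : p * p' = p + p' := hpp'.mul_eq_add
  have hp'2 : 2 < p' := by nlinarith [hpp'.symm.lt]
  set W := ∑ t ∈ s, ‖c t‖ ^ p' with hW
  change W ≤ _
  have hS0 : 0 ≤ ∑ j ∈ s, ‖b j‖ ^ p := Finset.sum_nonneg fun _ _ => by positivity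
  have hA0 : 0 ≤ A := hS0.trans hA
  have hW0 : 0 ≤ W := Finset.sum_nonneg fun _ _ => by positivity
  rcases hW0.eq_or_lt with h0 | hWpos
  · rw [← h0]; positivity
  -- Test against the norming sequence of c: since (p' - 1)p = p', both the pairing and the sum of
  -- p-th powers equal `W`.
  have key := hausdorff_young_bilinear K hpp' hp2 (fun t => ‖c t‖ ^ (p' - 2) • c t) b hL
  have h1 : ∀ t, inner ℝ (‖c t‖ ^ (p' - 2) • c t) (c t) = ‖c t‖ ^ p' := by
    intro t
    rw [real_inner_smul_left, real_inner_self_eq_norm_sq]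
    rcases (norm_nonneg (c t)).eq_or_lt with h | h
    · rw [← h, Real.zero_rpow hp'0.ne']; simp
    · rw [← Real.rpow_natCast, ← Real.rpow_add h]; norm_num
  have h2 : ∀ t, ‖‖c t‖ ^ (p' - 2) • c t‖ ^ p = ‖c t‖ ^ p' := by
    intro t
    rcases (norm_nonneg (c t)).eq_or_lt with h | h
    · rw [norm_eq_zero.1 h.symm]; simp [Real.zero_rpow hp'0.ne', Real.zero_rpow hp0.ne']
    · rw [norm_smul, Real.norm_of_nonneg (by positivity), ← Real.rpow_add_one h.ne',
        ← Real.rpow_mul h.le]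
      congr 1; linear_combination hmul
  have h3 : ∑ t ∈ s, inner ℝ (‖c t‖ ^ (p' - 2) • c t) (c t) = W :=
    Finset.sum_congr rfl fun t _ => h1 t
  have h4 : ∑ t ∈ s, ‖‖c t‖ ^ (p' - 2) • c t‖ ^ p = W :=
    Finset.sum_congr rfl fun t _ => h2 t
  change |∑ t ∈ s, inner ℝ (‖c t‖ ^ (p' - 2) • c t) (c t)| ≤ _ at key
  rw [h3, h4, abs_of_pos hWpos] at key
  -- The p'-th power of the bound is W^p' ≤ L^(p'-2) W^(p'-1) ∑ ‖b j‖^p; dividing by the positive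
  -- W^(p'-1) finishes.
  have h5 := Real.rpow_le_rpow hW0 key hp'0.le
  have hLW : 0 ≤ L * W := by positivity
  rw [Real.mul_rpow (by positivity) (by positivity), ← Real.rpow_mul hLW,
    ← Real.rpow_mul (by positivity), div_mul_cancel₀ _ hp'0.ne',
    show (1 - 2 / p') * p' = p' - 2 by field_simp, Real.mul_rpow hL0 hW0, Real.rpow_two, mul_pow,
    Real.sq_sqrt hW0, Real.sq_sqrt hS0] at h5
  have h6 : W ^ p' = W * (W * W ^ (p' - 2)) := by
    rw [← Real.rpow_one_add' hW0 (by linarith), ← Real.rpow_one_add' hW0 (by linarith)]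
    ring_nf
  rw [h6] at h5
  have h7 : 0 < W * W ^ (p' - 2) := by positivity
  have h8 : W ≤ L ^ (p' - 2) * ∑ j ∈ s, ‖b j‖ ^ p := by
    refine le_of_mul_le_mul_right (h5.trans_eq ?_) h7
    ring
  exact h8.trans (by gcongr)

/-! ### Khintchine's inequalities -/

/-- The signed sum `∑ ± v i`, with signs prescribed by `σ`. -/
def signSum {G : Type*} [AddCommGroup G] {n : ℕ} (σ : Fin n → Bool) (v : Fin n → G) : G :=
  ∑ i, if σ i then v i else -v i

theorem sum_signs_succ {n : ℕ} (f : (Fin (n + 1) → Bool) → ℝ) :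
    ∑ σ, f σ = ∑ σ : Fin n → Bool, (f (Fin.cons true σ) + f (Fin.cons false σ)) := by
  rw [← (Fin.consEquiv fun _ => Bool).sum_comp f, Fintype.sum_prod_type, Fintype.sum_bool,
    ← Finset.sum_add_distrib]
  rfl

theorem signSum_cons_true {G : Type*} [AddCommGroup G] {n : ℕ} (σ : Fin n → Bool)
    (v : Fin (n + 1) → G) :
    signSum (Fin.cons true σ : Fin (n + 1) → Bool) v = signSum σ (fun i => v i.succ) + v 0 := by
  simp [signSum, Fin.sum_univ_succ, add_comm]

theorem signSum_cons_false {G : Type*} [AddCommGroup G] {n : ℕ} (σ : Fin n → Bool)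
    (v : Fin (n + 1) → G) :
    signSum (Fin.cons false σ : Fin (n + 1) → Bool) v = signSum σ (fun i => v i.succ) - v 0 := by
  simp [signSum, Fin.sum_univ_succ, sub_eq_neg_add]

theorem map_signSum {G G' : Type*} [AddCommGroup G] [AddCommGroup G'] (f : G →+ G') {n : ℕ}
    (σ : Fin n → Bool) (v : Fin n → G) : f (signSum σ v) = signSum σ (fun i => f (v i)) := by
  simp only [signSum, map_sum]
  refine Finset.sum_congr rfl fun i _ => ?_
  split_ifs <;> simp

theorem sum_norm_signSum_sq {H : Type*} [NormedAddCommGroup H] [InnerProductSpace ℝ H] {n : ℕ}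
    (v : Fin n → H) : ∑ σ : Fin n → Bool, ‖signSum σ v‖ ^ 2 = 2 ^ n * ∑ i, ‖v i‖ ^ 2 := by
  induction n with
  | zero => simp [signSum]
  | succ n ih =>
    rw [sum_signs_succ, Fin.sum_univ_succ]
    simp_rw [signSum_cons_true, signSum_cons_false, norm_add_sq_real, norm_sub_sq_real]
    have : ∀ σ : Fin n → Bool, ‖signSum σ fun i => v i.succ‖ ^ 2 +
        2 * inner ℝ (signSum σ fun i => v i.succ) (v 0) + ‖v 0‖ ^ 2 +
        (‖signSum σ fun i => v i.succ‖ ^ 2 -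
          2 * inner ℝ (signSum σ fun i => v i.succ) (v 0) + ‖v 0‖ ^ 2) =
        2 * ‖signSum σ fun i => v i.succ‖ ^ 2 + 2 * ‖v 0‖ ^ 2 := fun σ => by ring
    simp_rw [this]
    rw [Finset.sum_add_distrib, ← Finset.mul_sum, ih]
    simp only [Finset.sum_const, Finset.card_univ, Fintype.card_fun, Fintype.card_bool,
      Fintype.card_fin, nsmul_eq_mul]
    push_cast
    ring

/-- Induction on n: averaging the signs of one vector y cancels the odd terms, and Cauchy–Schwarz
bounds the remaining inner product. The constant 3 is the Gaussian fourth moment. -/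
theorem sum_norm_signSum_four_le {H : Type*} [NormedAddCommGroup H] [InnerProductSpace ℝ H]
    {n : ℕ} (v : Fin n → H) :
    ∑ σ : Fin n → Bool, ‖signSum σ v‖ ^ 4 ≤ 2 ^ n * (3 * (∑ i, ‖v i‖ ^ 2) ^ 2) := by
  induction n with
  | zero => simp [signSum]
  | succ n ih =>
    rw [sum_signs_succ, Fin.sum_univ_succ]
    simp_rw [signSum_cons_true, signSum_cons_false]
    have h1 : ∀ x y : H, ‖x + y‖ ^ 4 + ‖x - y‖ ^ 4 ≤
        2 * ‖x‖ ^ 4 + 12 * ‖y‖ ^ 2 * ‖x‖ ^ 2 + 2 * ‖y‖ ^ 4 := by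
      intro x y
      have e1 : ‖x + y‖ ^ 4 = (‖x‖ ^ 2 + 2 * inner ℝ x y + ‖y‖ ^ 2) ^ 2 := by
        rw [← norm_add_sq_real]; ring
      have e2 : ‖x - y‖ ^ 4 = (‖x‖ ^ 2 - 2 * inner ℝ x y + ‖y‖ ^ 2) ^ 2 := by
        rw [← norm_sub_sq_real]; ring
      rw [e1, e2]
      have h3 := sq_le_sq' (by linarith [abs_real_inner_le_norm x y, neg_abs_le (inner ℝ x y)])
        ((le_abs_self _).trans (abs_real_inner_le_norm x y))
      nlinarith
    refine (Finset.sum_le_sum fun σ _ => h1 _ _).trans ?_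
    rw [Finset.sum_add_distrib, Finset.sum_add_distrib, ← Finset.mul_sum, ← Finset.mul_sum,
      sum_norm_signSum_sq]
    simp only [Finset.sum_const, Finset.card_univ, Fintype.card_fun, Fintype.card_bool,
      Fintype.card_fin, nsmul_eq_mul]
    push_cast
    have h2 := ih (fun i => v i.succ)
    set B := ∑ i : Fin n, ‖v i.succ‖ ^ 2
    have h3 : (0 : ℝ) < 2 ^ n := by positivity
    have h4 : 0 ≤ 2 ^ n * ‖v 0‖ ^ 4 := by positivity
    rw [pow_succ (2 : ℝ) n]
    nlinarith

/-- Bound y^p below by 2^(p-2) (y² - y⁴/4): for y ≤ 2 this is monotonicity of y^(p-2), for y > 2 the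
right side is negative. The second and fourth moments leave 1 - 3/4 = 1/4, hence the constant
2^(p-4). -/
theorem khintchine_lower {H : Type*} [NormedAddCommGroup H] [InnerProductSpace ℝ H]
    {n : ℕ} (v : Fin n → H) {p : ℝ} (hp0 : 0 < p) (hp2 : p < 2) :
    (2 : ℝ) ^ (p - 4) * √(∑ i, ‖v i‖ ^ 2) ^ p * 2 ^ n ≤ ∑ σ : Fin n → Bool, ‖signSum σ v‖ ^ p := by
  have hB0 : 0 ≤ ∑ i, ‖v i‖ ^ 2 := Finset.sum_nonneg fun _ _ => by positivity
  set β := √(∑ i, ‖v i‖ ^ 2) with hβ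
  have hβ2 : β ^ 2 = ∑ i, ‖v i‖ ^ 2 := Real.sq_sqrt hB0
  have hβ0 : 0 ≤ β := Real.sqrt_nonneg _
  rcases hβ0.eq_or_lt with h0 | hpos
  · rw [← h0, Real.zero_rpow hp0.ne']
    simp only [mul_zero, zero_mul]
    exact Finset.sum_nonneg fun _ _ => by positivity
  have hpt : ∀ y : ℝ, 0 ≤ y → (2 : ℝ) ^ (p - 2) * (y ^ 2 - y ^ 4 / 4) ≤ y ^ p := by
    intro y hy
    rcases hy.eq_or_lt with h | h
    · rw [← h, Real.zero_rpow hp0.ne']; simp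
    rcases le_or_gt y 2 with h2 | h2
    · have e : y ^ p = y ^ (p - 2) * y ^ 2 := by
        rw [← Real.rpow_natCast, ← Real.rpow_add h]; norm_num
      rw [e]
      refine mul_le_mul (Real.rpow_le_rpow_of_nonpos h h2 (by linarith)) ?_ ?_ (by positivity)
      · linarith [pow_pos h 4]
      · nlinarith [mul_nonneg (sq_nonneg y) (by nlinarith : 0 ≤ 4 - y ^ 2)]
    · have h3 : 4 ≤ y ^ 2 := by nlinarith
      have : y ^ 2 - y ^ 4 / 4 ≤ 0 := by nlinarith [mul_nonneg (sq_nonneg y) (sub_nonneg.2 h3)]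
      exact (mul_nonpos_of_nonneg_of_nonpos (by positivity) this).trans (by positivity)
  have h1 : ∀ σ : Fin n → Bool, (2 : ℝ) ^ (p - 2) * β ^ p *
      (‖signSum σ v‖ ^ 2 / β ^ 2 - ‖signSum σ v‖ ^ 4 / β ^ 4 / 4) ≤ ‖signSum σ v‖ ^ p := by
    intro σ
    have := hpt (‖signSum σ v‖ / β) (by positivity)
    rw [Real.div_rpow (norm_nonneg _) hpos.le, le_div_iff₀ (by positivity)] at this
    refine le_trans (le_of_eq ?_) this
    rw [div_pow, div_pow]; ring
  refine le_trans ?_ (Finset.sum_le_sum fun σ _ => h1 σ)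
  rw [← Finset.mul_sum, Finset.sum_sub_distrib, ← Finset.sum_div, ← Finset.sum_div,
    ← Finset.sum_div, sum_norm_signSum_sq, ← hβ2]
  have h4 := sum_norm_signSum_four_le v
  rw [← hβ2] at h4
  have h5 : (∑ σ : Fin n → Bool, ‖signSum σ v‖ ^ 4) / β ^ 4 ≤ 2 ^ n * 3 := by
    rw [div_le_iff₀ (by positivity)]; linarith
  have h6 : (2 : ℝ) ^ n * β ^ 2 / β ^ 2 = 2 ^ n := mul_div_cancel_right₀ _ (by positivity)
  have h7 : (2 : ℝ) ^ (p - 2) = 2 ^ (p - 4) * 4 := by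
    rw [show p - 2 = (p - 4) + 2 by ring, Real.rpow_add two_pos]; norm_num
  rw [h6, h7]
  have h8 : 0 < (2 : ℝ) ^ (p - 4) * β ^ p := by positivity
  nlinarith

/-- Subgaussian bound: the exponential moment is a product of cosh v_i, each at most exp(v_i²/2). -/
theorem sum_exp_signSum_le {n : ℕ} (v : Fin n → ℝ) :
    ∑ σ : Fin n → Bool, Real.exp (signSum σ v) ≤ 2 ^ n * Real.exp ((∑ i, v i ^ 2) / 2) := by
  induction n with
  | zero => simp [signSum]
  | succ n ih =>
    rw [sum_signs_succ, Fin.sum_univ_succ]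
    simp_rw [signSum_cons_true, signSum_cons_false]
    have h1 : ∀ x : ℝ, Real.exp (x + v 0) + Real.exp (x - v 0) =
        2 * Real.cosh (v 0) * Real.exp x := by
      intro x
      rw [Real.cosh_eq, sub_eq_add_neg, Real.exp_add, Real.exp_add]; ring
    simp_rw [h1]
    rw [← Finset.mul_sum, add_div, Real.exp_add, pow_succ]
    calc 2 * Real.cosh (v 0) * ∑ σ : Fin n → Bool, Real.exp (signSum σ fun i => v i.succ)
        ≤ 2 * Real.exp (v 0 ^ 2 / 2) *
          (2 ^ n * Real.exp ((∑ i : Fin n, v i.succ ^ 2) / 2)) := by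
          gcongr
          · exact Real.cosh_le_exp_half_sq _
          · exact ih _
      _ = _ := by ring

theorem exists_khintchine_upper_real {q : ℝ} (hq : 0 < q) : ∃ C : ℝ, 0 < C ∧
    ∀ (n : ℕ) (v : Fin n → ℝ),
      ∑ σ : Fin n → Bool, |signSum σ v| ^ q ≤ C * √(∑ i, v i ^ 2) ^ q * 2 ^ n := by
  obtain ⟨m, hm⟩ := exists_nat_ge q
  -- Powers are dominated by e^y + e^(-y) at the cost of 1 + m!. After normalisation to ∑ v_i² = 1,
  -- each of the two exponentials has mean at most e^(1/2).
  refine ⟨(1 + m.factorial) * (2 * Real.exp (1 / 2)), by positivity, fun n v => ?_⟩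
  have hpt : ∀ y : ℝ, |y| ^ q ≤ (1 + m.factorial) * (Real.exp y + Real.exp (-y)) := by
    intro y
    have h1 : |y| ^ q ≤ 1 + |y| ^ m := by
      rcases le_or_gt |y| 1 with h | h
      · have := Real.rpow_le_one (abs_nonneg y) h hq.le
        have : 0 ≤ |y| ^ m := by positivity
        linarith
      · have := Real.rpow_le_rpow_of_exponent_le h.le hm
        rw [Real.rpow_natCast] at this
        linarith
    have h2 := Real.pow_div_factorial_le_exp _ (abs_nonneg y) m
    rw [div_le_iff₀ (by positivity)] at h2
    have h3 : 1 ≤ Real.exp |y| := Real.one_le_exp (abs_nonneg y)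
    have h4 : Real.exp |y| ≤ Real.exp y + Real.exp (-y) := by
      rcases abs_choice y with h | h <;> rw [h] <;> linarith [Real.exp_pos y, Real.exp_pos (-y)]
    have h5 : (0 : ℝ) < m.factorial := by positivity
    nlinarith
  have hB0 : 0 ≤ ∑ i, v i ^ 2 := Finset.sum_nonneg fun _ _ => by positivity
  set β := √(∑ i, v i ^ 2) with hβ
  have hβ2 : β ^ 2 = ∑ i, v i ^ 2 := Real.sq_sqrt hB0
  have hβ0 : 0 ≤ β := Real.sqrt_nonneg _
  rcases hβ0.eq_or_lt with h0 | hpos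
  · have hv : ∀ i, v i = 0 := by
      intro i
      rw [← h0, zero_pow two_ne_zero, eq_comm,
        Finset.sum_eq_zero_iff_of_nonneg fun _ _ => sq_nonneg _] at hβ2
      exact pow_eq_zero_iff two_ne_zero |>.1 (hβ2 i (Finset.mem_univ _))
    simp [signSum, hv, Real.zero_rpow hq.ne']
    positivity
  have hscale : ∀ σ : Fin n → Bool, signSum σ v / β = signSum σ (fun i => v i / β) := fun σ =>
    map_signSum (AddMonoidHom.mulRight β⁻¹) σ v
  have hneg : ∀ σ : Fin n → Bool, -(signSum σ v / β) = signSum σ (fun i => -(v i / β)) := fun σ => by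
    rw [hscale]; exact map_signSum (-AddMonoidHom.id ℝ) σ _
  have hone : ∑ i, (v i / β) ^ 2 = 1 := by
    simp_rw [div_pow]
    rw [← Finset.sum_div, ← hβ2, div_self (by positivity)]
  have h1 : ∀ σ : Fin n → Bool, |signSum σ v| ^ q ≤ β ^ q * ((1 + m.factorial) *
      (Real.exp (signSum σ (fun i => v i / β)) + Real.exp (signSum σ (fun i => -(v i / β))))) := by
    intro σ
    have := hpt (signSum σ v / β)
    rw [abs_div, abs_of_pos hpos, Real.div_rpow (abs_nonneg _) hpos.le,
      div_le_iff₀ (by positivity), hneg, hscale] at this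
    linarith
  refine (Finset.sum_le_sum fun σ _ => h1 σ).trans ?_
  rw [← Finset.mul_sum, ← Finset.mul_sum, Finset.sum_add_distrib]
  have h2 := sum_exp_signSum_le (fun i => v i / β)
  have h3 := sum_exp_signSum_le (fun i => -(v i / β))
  simp_rw [neg_sq] at h3
  rw [hone] at h2 h3
  have h4 : 0 < β ^ q * (1 + (m.factorial : ℝ)) := by positivity
  nlinarith

theorem exists_khintchine_upper (𝕜 : Type*) [RCLike 𝕜] {q : ℝ} (hq : 0 < q) : ∃ C : ℝ, 0 < C ∧
    ∀ (n : ℕ) (v : Fin n → 𝕜),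
      ∑ σ : Fin n → Bool, ‖signSum σ v‖ ^ q ≤ C * √(∑ i, ‖v i‖ ^ 2) ^ q * 2 ^ n := by
  obtain ⟨C, hC, h⟩ := exists_khintchine_upper_real hq
  refine ⟨2 ^ q * (2 * C), by positivity, fun n v => ?_⟩
  have hre : ∀ σ : Fin n → Bool, RCLike.re (signSum σ v) = signSum σ (fun i => RCLike.re (v i)) :=
    fun σ => map_signSum (RCLike.re : 𝕜 →+ ℝ) σ v
  have him : ∀ σ : Fin n → Bool, RCLike.im (signSum σ v) = signSum σ (fun i => RCLike.im (v i)) :=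
    fun σ => map_signSum (RCLike.im : 𝕜 →+ ℝ) σ v
  have h1 : ∀ z : 𝕜, ‖z‖ ^ q ≤ 2 ^ q * (|RCLike.re z| ^ q + |RCLike.im z| ^ q) := by
    intro z
    have h2 : ‖z‖ ≤ 2 * max |RCLike.re z| |RCLike.im z| := by
      have h3 := RCLike.norm_sq_eq_def (z := z)
      have : ‖z‖ ≤ |RCLike.re z| + |RCLike.im z| := by
        refine abs_le_of_sq_le_sq' ?_ (by positivity) |>.2
        nlinarith [abs_nonneg (RCLike.re z), abs_nonneg (RCLike.im z), sq_abs (RCLike.re z),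
          sq_abs (RCLike.im z), mul_nonneg (abs_nonneg (RCLike.re z)) (abs_nonneg (RCLike.im z))]
      linarith [le_max_left |RCLike.re z| |RCLike.im z|, le_max_right |RCLike.re z| |RCLike.im z|]
    refine (Real.rpow_le_rpow (norm_nonneg _) h2 hq.le).trans ?_
    rw [Real.mul_rpow (by norm_num) (by positivity)]
    gcongr
    rcases max_choice |RCLike.re z| |RCLike.im z| with h | h <;> rw [h]
    · linarith [Real.rpow_nonneg (abs_nonneg (RCLike.im z)) q]
    · linarith [Real.rpow_nonneg (abs_nonneg (RCLike.re z)) q]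
  refine (Finset.sum_le_sum fun σ _ => h1 _).trans ?_
  rw [← Finset.mul_sum, Finset.sum_add_distrib]
  simp_rw [hre, him]
  have h2 := h n (fun i => RCLike.re (v i))
  have h3 := h n (fun i => RCLike.im (v i))
  have h4 : √(∑ i, RCLike.re (v i) ^ 2) ^ q ≤ √(∑ i, ‖v i‖ ^ 2) ^ q := by
    refine Real.rpow_le_rpow (by positivity) (Real.sqrt_le_sqrt (Finset.sum_le_sum fun i _ => ?_)) hq.le
    exact sq_le_sq' (neg_le_of_abs_le (RCLike.abs_re_le_norm _)) (RCLike.re_le_norm _)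
  have h5 : √(∑ i, RCLike.im (v i) ^ 2) ^ q ≤ √(∑ i, ‖v i‖ ^ 2) ^ q := by
    refine Real.rpow_le_rpow (by positivity) (Real.sqrt_le_sqrt (Finset.sum_le_sum fun i _ => ?_)) hq.le
    exact sq_le_sq' (neg_le_of_abs_le (RCLike.abs_im_le_norm _)) (RCLike.im_le_norm _)
  have h6 : 0 < C * 2 ^ n := by positivity
  calc _ ≤ (2 : ℝ) ^ q * (C * √(∑ i, ‖v i‖ ^ 2) ^ q * 2 ^ n +
        C * √(∑ i, ‖v i‖ ^ 2) ^ q * 2 ^ n) := by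
        gcongr
        · exact h2.trans (by gcongr)
        · exact h3.trans (by gcongr)
    _ = _ := by ring

/-! ### Well-conditioned bases of finite-dimensional subspaces of `ℓ_p` -/

section LewisBasis

variable {𝕜 : Type*} [RCLike 𝕜] {p : ℝ≥0∞} {n : ℕ}

/-- The vector of the `j`-th coordinates of a finite family of sequences. -/
def coordVec (y : Fin n → Ell 𝕜 p) (j : ℕ) : EuclideanSpace 𝕜 (Fin n) :=
  WithLp.toLp 2 fun i => y i j

/-- The `p`-th power of the `ℓ_p`-norm of the square function of a finite family of sequences. -/
noncomputable def squareEnergy (y : Fin n → Ell 𝕜 p) : ℝ :=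
  ∑' j, ‖coordVec y j‖ ^ p.toReal

theorem norm_apply_le_norm_coordVec (y : Fin n → Ell 𝕜 p) (i : Fin n) (j : ℕ) :
    ‖y i j‖ ≤ ‖coordVec y j‖ :=
  PiLp.norm_apply_le (coordVec y j) i

theorem summable_coordVec (hp0 : 0 < p.toReal) (y : Fin n → Ell 𝕜 p) :
    Summable fun j => ‖coordVec y j‖ ^ p.toReal := by
  have h : Memℓp (fun j => ∑ i, y i j • EuclideanSpace.single i (1 : 𝕜)) p := by
    refine Memℓp.finsetSum Finset.univ
      (f := fun i j => y i j • EuclideanSpace.single i (1 : 𝕜)) fun i _ => ?_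
    refine Memℓp.mono' (lp.memℓp (y i)) fun j => ?_
    simp [norm_smul]
  have h2 : (fun j => ∑ i, y i j • EuclideanSpace.single i (1 : 𝕜)) = coordVec y := by
    funext j
    ext k
    simp [coordVec, Pi.single_apply]
  rw [h2] at h
  exact h.summable hp0

theorem coordVec_smul (c : 𝕜) (y : Fin n → Ell 𝕜 p) (j : ℕ) :
    coordVec (c • y) j = c • coordVec y j := rfl

theorem squareEnergy_smul (c : 𝕜) (y : Fin n → Ell 𝕜 p) :
    squareEnergy (c • y) = ‖c‖ ^ p.toReal * squareEnergy y := by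
  simp only [squareEnergy, coordVec_smul, norm_smul,
    Real.mul_rpow (norm_nonneg _) (norm_nonneg _)]
  exact tsum_mul_left

theorem norm_rpow_le_squareEnergy (hp0 : 0 < p.toReal) (y : Fin n → Ell 𝕜 p) (i : Fin n) :
    ‖y i‖ ^ p.toReal ≤ squareEnergy y := by
  rw [lp.norm_rpow_eq_tsum hp0]
  refine Summable.tsum_le_tsum (fun j => ?_) ((lp.memℓp (y i)).summable hp0)
    (summable_coordVec hp0 y)
  gcongr
  exact norm_apply_le_norm_coordVec y i j

theorem squareEnergy_nonneg (y : Fin n → Ell 𝕜 p) : 0 ≤ squareEnergy y :=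
  tsum_nonneg fun _ => by positivity

end LewisBasis

theorem basis_det_sum_smul {R M : Type*} [CommRing R] [AddCommGroup M] [Module R M] {ι : Type*}
    [Fintype ι] [DecidableEq ι] (e : Module.Basis ι R M) (A : Matrix ι ι R) (y : ι → M) :
    e.det (fun i => ∑ k, A i k • y k) = A.det * e.det y := by
  rw [e.det_apply, e.det_apply, ← Matrix.det_transpose A, mul_comm, ← Matrix.det_mul]
  congr 1
  ext a b
  simp [Module.Basis.toMatrix_apply, Matrix.mul_apply, mul_comm]

/-- Take a family of energy 1 whose determinant exceeds half the supremum, so no maximiser is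
needed. General families reduce to energy 1 by homogeneity: the determinant has degree n and the
energy degree p, whence the exponent n/p. -/
theorem exists_almost_maximal_det {𝕜 : Type*} [RCLike 𝕜] {p : ℝ≥0∞} [Fact (1 ≤ p)]
    (hp : p ≠ ∞) {n : ℕ} (hn : 1 ≤ n) (E : Submodule 𝕜 (Ell 𝕜 p))
    (e : Module.Basis (Fin n) 𝕜 E) :
    ∃ y : Fin n → E, squareEnergy (fun i => (y i : Ell 𝕜 p)) = 1 ∧ 0 < ‖e.det y‖ ∧
      ∀ z : Fin n → E, ‖e.det z‖ ≤
        2 * ‖e.det y‖ * squareEnergy (fun i => (z i : Ell 𝕜 p)) ^ (n / p.toReal) := by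
  have hp1 : 1 ≤ p.toReal := by
    rw [← ENNReal.toReal_one]
    exact ENNReal.toReal_mono hp Fact.out
  have hp0 : 0 < p.toReal := by linarith
  let N : (Fin n → E) → ℝ := fun y => squareEnergy (fun i => (y i : Ell 𝕜 p))
  have hNsmul : ∀ (c : 𝕜) y, N (c • y) = ‖c‖ ^ p.toReal * N y := fun c y =>
    squareEnergy_smul c _
  have hdsmul : ∀ (c : 𝕜) y, ‖e.det (c • y)‖ = ‖c‖ ^ n * ‖e.det y‖ := by
    intro c y
    have := e.det.map_smul_univ (fun _ => c) y
    rw [show (c • y) = fun i => c • y i from rfl, this]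
    simp
  have hN0 : ∀ y, 0 ≤ N y := fun y => squareEnergy_nonneg _
  have hNpos : ∀ y, e.det y ≠ 0 → 0 < N y := by
    intro y hy
    refine (hN0 y).lt_of_ne fun h => hy ?_
    refine e.det.map_coord_zero ⟨0, hn⟩ ?_
    have h1 := norm_rpow_le_squareEnergy hp0 (fun i => (y i : Ell 𝕜 p)) ⟨0, hn⟩
    change _ ≤ N y at h1
    rw [← h] at h1
    have h2 := (Real.rpow_eq_zero (norm_nonneg _) hp0.ne').1
      (le_antisymm h1 (by positivity))
    exact Subtype.ext (norm_eq_zero.1 h2)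
  have hnorm : ∀ y, e.det y ≠ 0 → N (((N y ^ (-1 / p.toReal) : ℝ) : 𝕜) • y) = 1 ∧
      ‖e.det (((N y ^ (-1 / p.toReal) : ℝ) : 𝕜) • y)‖ * N y ^ (n / p.toReal) = ‖e.det y‖ := by
    intro y hy
    have h := hNpos y hy
    have h1 : ‖((N y ^ (-1 / p.toReal) : ℝ) : 𝕜)‖ = N y ^ (-1 / p.toReal) := by
      rw [RCLike.norm_ofReal, abs_of_pos (by positivity)]
    rw [hNsmul, hdsmul, h1, ← Real.rpow_mul h.le, div_mul_cancel₀ _ hp0.ne', Real.rpow_neg_one,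
      inv_mul_cancel₀ h.ne', ← Real.rpow_natCast, ← Real.rpow_mul h.le, mul_right_comm,
      ← Real.rpow_add h]
    refine ⟨rfl, ?_⟩
    rw [show -1 / p.toReal * n + n / p.toReal = 0 by ring, Real.rpow_zero, one_mul]
  let S : Set ℝ := {d | ∃ y, N y = 1 ∧ ‖e.det y‖ = d}
  have hSne : S.Nonempty := by
    have : e.det e ≠ 0 := by rw [e.det_self]; exact one_ne_zero
    exact ⟨_, _, (hnorm _ this).1, rfl⟩
  have hSbdd : BddAbove S := by
    let φ : E →L[𝕜] (Fin n → 𝕜) := (e.equivFunL : E →L[𝕜] (Fin n → 𝕜))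
    refine ⟨n.factorial • ‖φ‖ ^ n, ?_⟩
    rintro _ ⟨y, hy, rfl⟩
    have h1 : ∀ i, ‖y i‖ ≤ 1 := by
      intro i
      have h1 := norm_rpow_le_squareEnergy hp0 (fun i => (y i : Ell 𝕜 p)) i
      change _ ≤ N y at h1
      rw [hy] at h1
      by_contra! h2
      exact absurd (Real.one_lt_rpow h2 hp0) (not_lt.2 h1)
    have h2 := Matrix.det_le (A := e.toMatrix y) (abv := NormedField.toAbsoluteValue 𝕜)
      (x := ‖φ‖) (by
        intro i j
        calc ‖e.toMatrix y i j‖ = ‖φ (y j) i‖ := rfl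
          _ ≤ ‖φ (y j)‖ := norm_le_pi_norm _ _
          _ ≤ ‖φ‖ * ‖y j‖ := φ.le_opNorm _
          _ ≤ ‖φ‖ := mul_le_of_le_one_right φ.opNorm_nonneg (h1 j))
    rw [e.det_apply]
    exact h2.trans_eq (by simp)
  have hSpos : 0 < sSup S := by
    have h0 : e.det e ≠ 0 := by rw [e.det_self]; exact one_ne_zero
    have h1 := le_csSup hSbdd (show _ ∈ S from ⟨_, (hnorm _ h0).1, rfl⟩)
    refine lt_of_lt_of_le ?_ h1
    have h2 := (hnorm _ h0).2
    have h3 : 0 < ‖e.det e‖ := norm_pos_iff.2 h0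
    by_contra! h4
    have h5 := le_antisymm h4 (norm_nonneg _)
    rw [h5, zero_mul] at h2
    linarith
  obtain ⟨_, ⟨y, hy1, rfl⟩, hy2⟩ := exists_lt_of_lt_csSup hSne (half_lt_self hSpos)
  refine ⟨y, hy1, by linarith, fun z => ?_⟩
  by_cases hz : e.det z = 0
  · rw [hz, norm_zero]
    have := hN0 z
    positivity
  · have h1 := le_csSup hSbdd (show _ ∈ S from ⟨_, (hnorm z hz).1, rfl⟩)
    have h3 := hNpos z hz
    rw [← (hnorm z hz).2]
    change _ ≤ 2 * ‖e.det y‖ * N z ^ (n / p.toReal)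
    gcongr
    linarith

/-- Bernoulli's inequality: t^(r/2) is concave, so it lies below its tangent at S². -/
theorem rpow_sub_le {S x r : ℝ} (hS : 0 ≤ S) (hxS : x ≤ S ^ 2) (hr0 : 0 < r) (hr2 : r ≤ 2) :
    (S ^ 2 - x) ^ (r / 2) ≤ S ^ r - r / 2 * (S ^ (r - 2) * x) ∨ S = 0 := by
  rcases hS.eq_or_lt with h | h
  · exact Or.inr h.symm
  left
  have h1 := rpow_one_add_le_one_add_mul_self (s := -(x / S ^ 2)) (p := r / 2)
    (by rw [neg_le_neg_iff, div_le_one (by positivity)]; exact hxS) (by linarith) (by linarith)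
  have h2 : S ^ 2 - x = S ^ 2 * (1 + -(x / S ^ 2)) := by field_simp; ring
  have h3 : 0 ≤ 1 + -(x / S ^ 2) := by
    have : x / S ^ 2 ≤ 1 := by rw [div_le_one (by positivity)]; exact hxS
    linarith
  have h4 : (S ^ 2) ^ (r / 2) = S ^ r := by
    rw [← Real.rpow_natCast, ← Real.rpow_mul hS]; congr 1; push_cast; ring
  have h5 : S ^ r = S ^ (r - 2) * S ^ 2 := by
    rw [← Real.rpow_natCast, ← Real.rpow_add h]; norm_num
  rw [h2, Real.mul_rpow (by positivity) h3, h4]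
  calc S ^ r * (1 + -(x / S ^ 2)) ^ (r / 2) ≤ S ^ r * (1 + r / 2 * -(x / S ^ 2)) := by gcongr
    _ = S ^ r - r / 2 * (S ^ r / S ^ 2 * x) := by ring
    _ = _ := by rw [h5, mul_div_cancel_right₀ _ (by positivity)]

/-- A variational argument on an almost maximal determinant. Halving the family in the direction h
only halves the determinant, so the energy cannot drop by more than O(1/n); the drop controls the
quadratic sum. Since maximality is only approximate, the perturbation is of fixed size, not
infinitesimal. -/
theorem exists_well_conditioned_family {𝕜 : Type*} [RCLike 𝕜] {p : ℝ≥0∞} [Fact (1 ≤ p)]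
    (hp2 : p < 2) {n : ℕ} (hn : 1 ≤ n) (E : Submodule 𝕜 (Ell 𝕜 p))
    (hE : Module.finrank 𝕜 E = n) :
    ∃ y : Fin n → Ell 𝕜 p, (∀ i, y i ∈ E) ∧ squareEnergy y = 1 ∧
      ∀ (h : EuclideanSpace 𝕜 (Fin n)) (s : Finset ℕ), ‖h‖ = 1 →
        ∑ j ∈ s, ‖coordVec y j‖ ^ (p.toReal - 2) * ‖inner 𝕜 h (coordVec y j)‖ ^ 2 ≤ 4 / n := by
  have hp : p ≠ ∞ := (hp2.trans (by norm_num)).ne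
  have hr1 : 1 ≤ p.toReal := by
    rw [← ENNReal.toReal_one]
    exact ENNReal.toReal_mono hp Fact.out
  have hr2 : p.toReal ≤ 2 := by
    have := ENNReal.toReal_mono (by norm_num) hp2.le
    simpa using this
  set r := p.toReal with hr
  have hr0 : 0 < r := by linarith
  have hn0 : (0 : ℝ) < n := by exact_mod_cast hn
  have : FiniteDimensional 𝕜 E := FiniteDimensional.of_finrank_pos (by omega)
  let e : Module.Basis (Fin n) 𝕜 E := Module.finBasisOfFinrankEq 𝕜 E hE
  obtain ⟨y, hy1, hy0, hy⟩ := exists_almost_maximal_det hp hn E e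
  refine ⟨fun i => y i, fun i => (y i).2, hy1, fun h s hh => ?_⟩
  set b := coordVec (fun i => (y i : Ell 𝕜 p)) with hb
  -- A = 1 - ½ h h*, acting as ½ along h and as the identity on its orthogonal complement.
  let A : Matrix (Fin n) (Fin n) 𝕜 := 1 + Matrix.replicateCol Unit (fun i => -(1 / 2) * h i) *
    Matrix.replicateRow Unit (fun k => star (h k))
  have hA : A.det = 1 / 2 := by
    rw [Matrix.det_one_add_replicateCol_mul_replicateRow]
    have h1 : ∑ k, star (h k) * h k = 1 := by
      have := inner_self_eq_norm_sq_to_K (𝕜 := 𝕜) h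
      rw [hh, PiLp.inner_apply] at this
      simp only [RCLike.inner_apply'] at this
      simpa using this
    have h2 : (fun k => star (h k)) ⬝ᵥ (fun i => -(1 / 2) * h i) =
        -(1 / 2) * ∑ k, star (h k) * h k := by
      rw [dotProduct, Finset.mul_sum]
      exact Finset.sum_congr rfl fun k _ => by ring
    rw [h2, h1]; norm_num
  let z : Fin n → E := fun i => ∑ k, A i k • y k
  have hdz : ‖e.det z‖ = 1 / 2 * ‖e.det y‖ := by
    rw [basis_det_sum_smul, hA, norm_mul]
    congr 1
    rw [norm_div, norm_one, RCLike.norm_ofNat]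
  set c := coordVec (fun i => (z i : Ell 𝕜 p)) with hc
  have hcb : ∀ j, c j = b j - ((1 / 2 : 𝕜) * inner 𝕜 h (b j)) • h := by
    intro j
    refine PiLp.ext fun i => ?_
    have h1 : (c j) i = ∑ k, A i k * b j k := by
      simp only [hc, hb, coordVec, z]
      rw [AddSubmonoidClass.coe_finsetSum, lp.coeFn_sum, Finset.sum_apply]
      rfl
    rw [h1, PiLp.inner_apply, PiLp.sub_apply, PiLp.smul_apply, smul_eq_mul, sub_eq_add_neg]
    simp only [A, Matrix.add_apply, Matrix.mul_apply, Matrix.replicateCol_apply,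
      Matrix.replicateRow_apply, Finset.univ_unique, Finset.sum_const, Finset.card_singleton,
      one_smul, add_mul, Finset.sum_add_distrib, Matrix.one_apply, ite_mul, one_mul, zero_mul,
      Finset.sum_ite_eq, Finset.mem_univ, if_true, RCLike.inner_apply']
    congr 1
    rw [Finset.mul_sum, Finset.sum_mul, ← Finset.sum_neg_distrib]
    refine Finset.sum_congr rfl fun k _ => ?_
    simp only [starRingEnd_apply]
    ring
  have hcn : ∀ j, ‖c j‖ ^ 2 = ‖b j‖ ^ 2 - 3 / 4 * ‖inner 𝕜 h (b j)‖ ^ 2 := by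
    intro j
    rw [hcb, norm_sub_sq (𝕜 := 𝕜), inner_smul_right, norm_smul, hh, mul_one, norm_mul,
      ← inner_conj_symm (b j) h, mul_assoc, RCLike.mul_conj]
    have h2 : ‖(1 / 2 : 𝕜)‖ = 1 / 2 := by rw [norm_div, norm_one, RCLike.norm_ofNat]
    have h3 : RCLike.re ((1 / 2 : 𝕜) * (‖inner 𝕜 h (b j)‖ : 𝕜) ^ 2) =
        1 / 2 * ‖inner 𝕜 h (b j)‖ ^ 2 := by
      have : (1 / 2 : 𝕜) * (‖inner 𝕜 h (b j)‖ : 𝕜) ^ 2 =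
        ((1 / 2 * ‖inner 𝕜 h (b j)‖ ^ 2 : ℝ) : 𝕜) := by push_cast; ring
      rw [this, RCLike.ofReal_re]
    rw [h2, h3]; ring
  have hle : ∀ j, ‖inner 𝕜 h (b j)‖ ^ 2 ≤ ‖b j‖ ^ 2 := by
    intro j
    have := norm_inner_le_norm (𝕜 := 𝕜) h (b j)
    rw [hh, one_mul] at this
    gcongr
  have hpt : ∀ j, ‖c j‖ ^ r ≤ ‖b j‖ ^ r -
      r / 2 * (‖b j‖ ^ (r - 2) * (3 / 4 * ‖inner 𝕜 h (b j)‖ ^ 2)) := by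
    intro j
    have h1 : ‖c j‖ ^ r = (‖b j‖ ^ 2 - 3 / 4 * ‖inner 𝕜 h (b j)‖ ^ 2) ^ (r / 2) := by
      rw [← hcn, ← Real.rpow_natCast, ← Real.rpow_mul (norm_nonneg _)]
      congr 1; push_cast; ring
    rw [h1]
    rcases rpow_sub_le (x := 3 / 4 * ‖inner 𝕜 h (b j)‖ ^ 2) (norm_nonneg (b j))
      (by linarith [hle j, sq_nonneg ‖inner 𝕜 h (b j)‖]) hr0 hr2 with h2 | h2
    · exact h2
    · rw [norm_eq_zero.1 h2]; simp [Real.zero_rpow hr0.ne', (by linarith : r / 2 ≠ 0)]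
  set Q := ∑ j ∈ s, ‖b j‖ ^ (r - 2) * ‖inner 𝕜 h (b j)‖ ^ 2 with hQ
  have hsb : Summable fun j => ‖b j‖ ^ r := summable_coordVec hr0 _
  have hsc : Summable fun j => ‖c j‖ ^ r := summable_coordVec hr0 _
  have h1 : ∑' j, ‖c j‖ ^ r + 3 / 8 * r * Q ≤ 1 := by
    have h2 : 3 / 8 * r * Q ≤ ∑' j, (‖b j‖ ^ r - ‖c j‖ ^ r) := by
      refine le_trans ?_ ((hsb.sub hsc).sum_le_tsum s fun j _ => ?_)
      · rw [hQ, Finset.mul_sum]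
        refine Finset.sum_le_sum fun j _ => ?_
        linarith [hpt j]
      · have : 0 ≤ r / 2 * (‖b j‖ ^ (r - 2) * (3 / 4 * ‖inner 𝕜 h (b j)‖ ^ 2)) := by positivity
        linarith [hpt j]
    rw [hsb.tsum_sub hsc] at h2
    have h3 : ∑' j, ‖b j‖ ^ r = 1 := hy1
    linarith
  have h2 : (1 / 4 : ℝ) ≤ (∑' j, ‖c j‖ ^ r) ^ (n / r) := by
    have h3 := hy z
    rw [hdz] at h3
    change 1 / 2 * ‖e.det y‖ ≤ 2 * ‖e.det y‖ * (∑' j, ‖c j‖ ^ r) ^ (n / r) at h3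
    nlinarith
  set v := ∑' j, ‖c j‖ ^ r with hv
  have hv0 : 0 ≤ v := tsum_nonneg fun _ => by positivity
  have h3 : (1 / 4 : ℝ) ^ (r / n) ≤ v := by
    have := Real.rpow_le_rpow (by norm_num) h2 (by positivity : 0 ≤ r / n)
    rwa [← Real.rpow_mul hv0, div_mul_div_cancel₀ hr0.ne', div_self hn0.ne', Real.rpow_one] at this
  -- Almost maximality gives v ≥ 4^(-r/n), linearised here by e^x ≥ 1 + x. Comparison with v ≤ 1 -
  -- (3/8) r Q yields Q ≤ (16/3) log 2 / n < 4/n.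
  have h4 : 1 - r / n * (2 * Real.log 2) ≤ (1 / 4 : ℝ) ^ (r / n) := by
    rw [Real.rpow_def_of_pos (by norm_num)]
    have : Real.log (1 / 4) = -(2 * Real.log 2) := by
      rw [one_div, Real.log_inv, show (4 : ℝ) = 2 ^ 2 by norm_num, Real.log_pow]; norm_num
    rw [this]
    linarith [Real.add_one_le_exp (-(2 * Real.log 2) * (r / n))]
  have h5 : r * (3 / 8 * Q) ≤ r * (2 * Real.log 2 / n) := by
    have : r / n * (2 * Real.log 2) = r * (2 * Real.log 2 / n) := by ring
    linarith
  have h6 := le_of_mul_le_mul_left h5 hr0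
  have h7 := Real.log_two_lt_d9
  rw [le_div_iff₀ hn0] at h6 ⊢
  nlinarith

/-! ### The operator `ℓ_p → ℓ_p'` given by the block diagonal Hadamard matrix -/

section HadamardOperator

variable {𝕜 : Type*} [RCLike 𝕜]

/-- The image of a scalar sequence under the block diagonal Hadamard matrix. -/
noncomputable def hadamardSeq (s : ℝ) (x : ℕ → 𝕜) (i : ℕ) : 𝕜 :=
  ∑ j ∈ Finset.range (2 * i + 1), ((hadamardSumEntry s i j : ℝ) : 𝕜) * x j

theorem hadamardSumEntry_eq_zero_of_blockIndex_ne (s : ℝ) {i j : ℕ}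
    (h : blockIndex i ≠ blockIndex j) : hadamardSumEntry s i j = 0 := by
  rw [hadamardSumEntry_eq, hadamardSign, if_neg h, mul_zero]

theorem hadamardSumEntry_eq_zero_of_le (s : ℝ) {i j : ℕ} (h : 2 * i + 1 ≤ j) :
    hadamardSumEntry s i j = 0 := by
  rw [hadamardSumEntry_eq]
  by_contra h2
  exact absurd (hadamardSign_ne_zero (right_ne_zero_of_mul h2)) (not_lt.2 h)

theorem hadamardSumEntry_eq_zero_of_range (s : ℝ) {K i j : ℕ} (hi : i < 2 ^ K - 1)
    (hj : 2 ^ K - 1 ≤ j) : hadamardSumEntry s i j = 0 := by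
  refine hadamardSumEntry_eq_zero_of_blockIndex_ne s fun h => ?_
  have h1 := blockIndex_lt hi
  have h2 := (blockIndex_eq_iff (i := j)).1 rfl
  have h3 : 2 ^ (blockIndex j + 1) ≤ 2 ^ K := Nat.pow_le_pow_right (by norm_num) (by omega)
  omega

theorem hadamardSeq_eq_sum (s : ℝ) (x : ℕ → 𝕜) {K i : ℕ} (hi : i < 2 ^ K - 1) :
    hadamardSeq s x i = ∑ j ∈ Finset.range (2 ^ K - 1), hadamardSumEntry s i j • x j := by
  simp_rw [RCLike.real_smul_eq_coe_mul]
  have h1 : ∑' j, ((hadamardSumEntry s i j : ℝ) : 𝕜) * x j = hadamardSeq s x i :=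
    tsum_eq_sum fun j hj => by
      rw [hadamardSumEntry_eq_zero_of_le s (by simpa using hj)]; simp
  have h2 : ∑' j, ((hadamardSumEntry s i j : ℝ) : 𝕜) * x j =
      ∑ j ∈ Finset.range (2 ^ K - 1), ((hadamardSumEntry s i j : ℝ) : 𝕜) * x j :=
    tsum_eq_sum fun j hj => by
      rw [hadamardSumEntry_eq_zero_of_range s hi (by simpa using hj)]; simp
  rw [← h1, h2]

theorem exists_subset_range_two_pow (s : Finset ℕ) : ∃ K, s ⊆ Finset.range (2 ^ K - 1) := by
  refine ⟨s.sup id + 1, fun i hi => ?_⟩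
  have h1 : i ≤ s.sup id := Finset.le_sup (f := id) hi
  have h2 := Nat.lt_two_pow_self (n := s.sup id + 1)
  rw [Finset.mem_range]
  omega

variable {p p' : ℝ≥0∞}

/-- The scalar case of `hausdorff_young_hadamard`: Cauchy–Schwarz allows L = A = ‖x‖^p, and p(p' -
2) + p = p'. -/
theorem sum_norm_hadamardSeq_rpow_le [Fact (1 ≤ p)] (hpp' : p.toReal.HolderConjugate p'.toReal)
    (hp2 : p.toReal < 2) (x : Ell 𝕜 p) (s : Finset ℕ) :
    ∑ i ∈ s, ‖hadamardSeq p'.toReal x i‖ ^ p'.toReal ≤ ‖x‖ ^ p'.toReal := by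
  obtain ⟨K, hK⟩ := exists_subset_range_two_pow s
  have hr0 := hpp'.pos
  have hr'0 := hpp'.symm.pos
  have hA : ∑ j ∈ Finset.range (2 ^ K - 1), ‖x j‖ ^ p.toReal ≤ ‖x‖ ^ p.toReal :=
    lp.sum_rpow_le_norm_rpow hr0 x _
  have key := hausdorff_young_hadamard K hpp' hp2 (fun j => x j) (L := ‖x‖ ^ p.toReal)
    (by positivity) (fun h => ?_) hA
  · refine (Finset.sum_le_sum_of_subset_of_nonneg hK fun _ _ _ => by positivity).trans ?_
    have h1 : ∀ i ∈ Finset.range (2 ^ K - 1), ‖hadamardSeq p'.toReal x i‖ ^ p'.toReal =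
        ‖∑ j ∈ Finset.range (2 ^ K - 1), hadamardSumEntry p'.toReal i j • x j‖ ^ p'.toReal :=
      fun i hi => by rw [hadamardSeq_eq_sum _ _ (Finset.mem_range.1 hi)]
    rw [Finset.sum_congr rfl h1]
    refine key.trans_eq ?_
    rw [← Real.rpow_mul (norm_nonneg _)]
    have hmul := hpp'.mul_eq_add
    have hpos : 0 < p.toReal * (p'.toReal - 2) + p.toReal := by nlinarith [hpp'.lt]
    rw [← Real.rpow_add' (norm_nonneg _) hpos.ne']
    congr 1
    linear_combination hmul
  · calc ∑ j ∈ Finset.range (2 ^ K - 1), |inner ℝ h (x j)| * ‖x j‖ ^ (p.toReal - 1)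
        ≤ ∑ j ∈ Finset.range (2 ^ K - 1), ‖x j‖ ^ p.toReal * ‖h‖ := by
          refine Finset.sum_le_sum fun j _ => ?_
          have h1 : ‖x j‖ ^ p.toReal = ‖x j‖ * ‖x j‖ ^ (p.toReal - 1) := by
            rw [← Real.rpow_one_add' (norm_nonneg _) (by linarith)]; ring_nf
          rw [h1]
          calc _ ≤ (‖h‖ * ‖x j‖) * ‖x j‖ ^ (p.toReal - 1) := by
                gcongr; exact abs_real_inner_le_norm _ _
            _ = _ := by ring
      _ ≤ _ := by rw [← Finset.sum_mul]; gcongr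

theorem memℓp_hadamardSeq [Fact (1 ≤ p)] (hpp' : p.toReal.HolderConjugate p'.toReal)
    (hp2 : p.toReal < 2) (x : Ell 𝕜 p) :
    Memℓp (hadamardSeq p'.toReal (x : ℕ → 𝕜)) p' :=
  memℓp_gen' (sum_norm_hadamardSeq_rpow_le hpp' hp2 x)

/-- The operator `ℓ_p → ℓ_p'` whose matrix is block diagonal with blocks `2 ^ (-n / p') Hₙ`. -/
noncomputable def hadamardOp [Fact (1 ≤ p)] [Fact (1 ≤ p')]
    (hpp' : p.toReal.HolderConjugate p'.toReal)
    (hp2 : p.toReal < 2) : Ell 𝕜 p →L[𝕜] Ell 𝕜 p' :=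
  LinearMap.mkContinuous
    { toFun := fun x => ⟨hadamardSeq p'.toReal (x : ℕ → 𝕜), memℓp_hadamardSeq hpp' hp2 x⟩
      map_add' := fun x y => by
        refine lp.ext (funext fun i => ?_)
        change (hadamardSeq _ _ i : 𝕜) = hadamardSeq _ _ i + hadamardSeq _ _ i
        simp [hadamardSeq, mul_add, Finset.sum_add_distrib]
      map_smul' := fun c x => by
        refine lp.ext (funext fun i => ?_)
        change (hadamardSeq _ _ i : 𝕜) = c * hadamardSeq _ _ i
        simp [hadamardSeq, Finset.mul_sum, mul_left_comm] } 1
    (fun x => by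
      rw [one_mul]
      exact lp.norm_le_of_forall_sum_le hpp'.symm.pos (norm_nonneg _)
        (sum_norm_hadamardSeq_rpow_le hpp' hp2 x))

theorem hadamardOp_apply [Fact (1 ≤ p)] [Fact (1 ≤ p')]
    (hpp' : p.toReal.HolderConjugate p'.toReal)
    (hp2 : p.toReal < 2) (x : Ell 𝕜 p) (i : ℕ) :
    hadamardOp hpp' hp2 x i = hadamardSeq p'.toReal (x : ℕ → 𝕜) i := rfl

theorem hadamardOp_single [Fact (1 ≤ p)] [Fact (1 ≤ p')]
    (hpp' : p.toReal.HolderConjugate p'.toReal)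
    (hp2 : p.toReal < 2) (i j : ℕ) :
    hadamardOp hpp' hp2 (lp.single p j (1 : 𝕜)) i =
      ((hadamardSumEntry p'.toReal i j : ℝ) : 𝕜) := by
  rw [hadamardOp_apply, hadamardSeq, Finset.sum_eq_single j]
  · rw [lp.single_apply_self, mul_one]
  · intro l _ hl
    rw [lp.single_apply_ne p j _ hl, mul_zero]
  · intro h
    rw [hadamardSumEntry_eq_zero_of_le _ (by simpa using h)]; simp

end HadamardOperator

/-! ### Random signs and square functions in sequence spaces -/

section SignSums

variable {𝕜 : Type*} [RCLike 𝕜] {q : ℝ≥0∞} {n : ℕ}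

theorem norm_coordVec_eq_sqrt (z : Fin n → Ell 𝕜 q) (j : ℕ) :
    ‖coordVec z j‖ = √(∑ i, ‖z i j‖ ^ 2) :=
  EuclideanSpace.norm_eq _

theorem signSum_apply (σ : Fin n → Bool) (z : Fin n → Ell 𝕜 q) (j : ℕ) :
    signSum σ z j = signSum σ (fun i => z i j) :=
  map_signSum ((Pi.evalAddMonoidHom (fun _ : ℕ => 𝕜) j).comp
    (lp.coeFnAddMonoidHom (fun _ : ℕ => 𝕜) q)) σ z

/-- Exchanging the sum over signs with the sum over coordinates reduces Khintchine in ℓ_q to scalar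
inequalities. -/
theorem sum_norm_signSum_rpow_eq (hq : 0 < q.toReal) (z : Fin n → Ell 𝕜 q) :
    ∑ σ : Fin n → Bool, ‖signSum σ z‖ ^ q.toReal =
      ∑' j, ∑ σ : Fin n → Bool, ‖signSum σ (fun i => z i j)‖ ^ q.toReal := by
  have h1 : ∀ σ : Fin n → Bool,
      Summable fun j => ‖signSum σ (fun i => z i j)‖ ^ q.toReal := by
    intro σ
    have := (lp.memℓp (signSum σ z)).summable hq
    simpa only [signSum_apply] using this
  rw [Summable.tsum_finsetSum fun σ _ => h1 σ]
  refine Finset.sum_congr rfl fun σ _ => ?_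
  rw [lp.norm_rpow_eq_tsum hq]
  simp only [signSum_apply]

theorem summable_sum_norm_signSum (hq : 0 < q.toReal) (z : Fin n → Ell 𝕜 q) :
    Summable fun j => ∑ σ : Fin n → Bool, ‖signSum σ (fun i => z i j)‖ ^ q.toReal := by
  refine summable_sum fun σ _ => ?_
  have := (lp.memℓp (signSum σ z)).summable hq
  simpa only [signSum_apply] using this

theorem le_sum_norm_signSum_rpow (hq : 0 < q.toReal) (hq2 : q.toReal < 2)
    (z : Fin n → Ell 𝕜 q) :
    (2 : ℝ) ^ (q.toReal - 4) * squareEnergy z * 2 ^ n ≤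
      ∑ σ : Fin n → Bool, ‖signSum σ z‖ ^ q.toReal := by
  rw [sum_norm_signSum_rpow_eq hq, squareEnergy, ← tsum_mul_left, ← tsum_mul_right]
  refine Summable.tsum_le_tsum (fun j => ?_) (((summable_coordVec hq z).mul_left _).mul_right _)
    (summable_sum_norm_signSum hq z)
  rw [norm_coordVec_eq_sqrt]
  exact khintchine_lower (fun i => z i j) hq hq2

theorem exists_sum_norm_signSum_rpow_le (𝕜 : Type*) [RCLike 𝕜] {q : ℝ≥0∞} (hq : 0 < q.toReal) :
    ∃ C : ℝ, 0 < C ∧ ∀ (n : ℕ) (z : Fin n → Ell 𝕜 q),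
      ∑ σ : Fin n → Bool, ‖signSum σ z‖ ^ q.toReal ≤ C * squareEnergy z * 2 ^ n := by
  obtain ⟨C, hC, h⟩ := exists_khintchine_upper 𝕜 hq
  refine ⟨C, hC, fun n z => ?_⟩
  rw [sum_norm_signSum_rpow_eq hq, squareEnergy, ← tsum_mul_left, ← tsum_mul_right]
  refine Summable.tsum_le_tsum (fun j => ?_) (summable_sum_norm_signSum hq z)
    (((summable_coordVec hq z).mul_left _).mul_right _)
  rw [norm_coordVec_eq_sqrt]
  exact h n (fun i => z i j)

end SignSums

/-! ### The Hadamard operator is finitely strictly singular -/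

section FinitelyStrictlySingular

variable {𝕜 : Type*} [RCLike 𝕜] {p p' : ℝ≥0∞} [Fact (1 ≤ p)] [Fact (1 ≤ p')]
  (hpp' : p.toReal.HolderConjugate p'.toReal) (hp2 : p.toReal < 2)

/-- Cauchy–Schwarz with the splitting r - 1 = (r/2 - 1) + r/2; the two factors contribute √(4/n) and
1. This is the hypothesis of `hausdorff_young_hadamard` with L = 2/√n. -/
theorem sum_abs_inner_mul_rpow_le {n : ℕ} {r : ℝ} (b : ℕ → EuclideanSpace 𝕜 (Fin n))
    (s : Finset ℕ) (hs : ∑ j ∈ s, ‖b j‖ ^ r ≤ 1)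
    (hQ : ∀ h : EuclideanSpace 𝕜 (Fin n), ‖h‖ = 1 →
      ∑ j ∈ s, ‖b j‖ ^ (r - 2) * ‖inner 𝕜 h (b j)‖ ^ 2 ≤ 4 / n)
    (h : EuclideanSpace 𝕜 (Fin n)) :
    ∑ j ∈ s, |inner ℝ h (b j)| * ‖b j‖ ^ (r - 1) ≤ 2 / √n * ‖h‖ := by
  have hunit : ∀ u : EuclideanSpace 𝕜 (Fin n), ‖u‖ = 1 →
      ∑ j ∈ s, |inner ℝ u (b j)| * ‖b j‖ ^ (r - 1) ≤ 2 / √n := by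
    intro u hu
    have h1 : ∀ j ∈ s, |inner ℝ u (b j)| * ‖b j‖ ^ (r - 1) ≤
        (‖b j‖ ^ (r / 2 - 1) * ‖inner 𝕜 u (b j)‖) * ‖b j‖ ^ (r / 2) := by
      intro j _
      have h2 : |inner ℝ u (b j)| ≤ ‖inner 𝕜 u (b j)‖ := by
        have : inner ℝ u (b j) = RCLike.re (inner 𝕜 u (b j)) := by
          simp only [PiLp.inner_apply, map_sum]
          rfl
        rw [this]
        exact RCLike.abs_re_le_norm _
      rcases (norm_nonneg (b j)).eq_or_lt with h | h
      · rw [norm_eq_zero.1 h.symm]; simp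
      · have h3 : ‖b j‖ ^ (r - 1) = ‖b j‖ ^ (r / 2 - 1) * ‖b j‖ ^ (r / 2) := by
          rw [← Real.rpow_add h]; ring_nf
        rw [h3, mul_comm (‖b j‖ ^ (r / 2 - 1)) ‖inner 𝕜 u (b j)‖, mul_assoc]
        exact mul_le_mul_of_nonneg_right h2 (by positivity)
    refine (Finset.sum_le_sum h1).trans ((Real.sum_mul_le_sqrt_mul_sqrt _ _ _).trans ?_)
    have h4 : ∀ j ∈ s, (‖b j‖ ^ (r / 2 - 1) * ‖inner 𝕜 u (b j)‖) ^ 2 =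
        ‖b j‖ ^ (r - 2) * ‖inner 𝕜 u (b j)‖ ^ 2 := by
      intro j _
      rw [mul_pow, ← Real.rpow_natCast (‖b j‖ ^ (r / 2 - 1)), ← Real.rpow_mul (norm_nonneg _)]
      congr 2; push_cast; ring
    have h5 : ∀ j ∈ s, (‖b j‖ ^ (r / 2)) ^ 2 = ‖b j‖ ^ r := by
      intro j _
      rw [← Real.rpow_natCast, ← Real.rpow_mul (norm_nonneg _)]
      congr 1; push_cast; ring
    rw [Finset.sum_congr rfl h4, Finset.sum_congr rfl h5]
    refine (mul_le_mul (Real.sqrt_le_sqrt (hQ u hu)) (Real.sqrt_le_sqrt hs) (Real.sqrt_nonneg _)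
      (Real.sqrt_nonneg _)).trans_eq ?_
    rw [Real.sqrt_one, mul_one, Real.sqrt_div (by norm_num), show (4 : ℝ) = 2 ^ 2 by norm_num,
      Real.sqrt_sq (by norm_num)]
  rcases eq_or_ne h 0 with h0 | h0
  · simp [h0]
  have hpos := norm_pos_iff.2 h0
  have h2 := hunit (‖h‖⁻¹ • h)
    (by rw [norm_smul, norm_inv, norm_norm, inv_mul_cancel₀ hpos.ne'])
  have h3 : ∀ j ∈ s, |inner ℝ (‖h‖⁻¹ • h) (b j)| * ‖b j‖ ^ (r - 1) =
      ‖h‖⁻¹ * (|inner ℝ h (b j)| * ‖b j‖ ^ (r - 1)) := by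
    intro j _
    rw [real_inner_smul_left, abs_mul, abs_inv, abs_norm, mul_assoc]
  rw [Finset.sum_congr rfl h3, ← Finset.mul_sum, inv_mul_le_iff₀ hpos, mul_comm] at h2
  exact h2

theorem squareEnergy_hadamardOp_le {n : ℕ} (y : Fin n → Ell 𝕜 p)
    (hy : squareEnergy y = 1)
    (hQ : ∀ (h : EuclideanSpace 𝕜 (Fin n)) (s : Finset ℕ), ‖h‖ = 1 →
      ∑ j ∈ s, ‖coordVec y j‖ ^ (p.toReal - 2) * ‖inner 𝕜 h (coordVec y j)‖ ^ 2 ≤ 4 / n) :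
    squareEnergy (fun i => hadamardOp hpp' hp2 (y i)) ≤ (2 / √n) ^ (p'.toReal - 2) := by
  have hsum : ∀ s : Finset ℕ, ∑ j ∈ s, ‖coordVec y j‖ ^ p.toReal ≤ 1 := fun s =>
    ((summable_coordVec hpp'.pos y).sum_le_tsum s fun _ _ => by positivity).trans_eq hy
  refine Real.tsum_le_of_sum_le (fun _ => by positivity) fun s => ?_
  obtain ⟨K, hK⟩ := exists_subset_range_two_pow s
  refine (Finset.sum_le_sum_of_subset_of_nonneg hK fun _ _ _ => by positivity).trans ?_
  have key := hausdorff_young_hadamard K hpp' hp2 (coordVec y) (L := 2 / √n) (A := 1)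
    (by positivity) (sum_abs_inner_mul_rpow_le _ _ (hsum _) fun h => hQ h _) (hsum _)
  rw [mul_one] at key
  refine le_trans (le_of_eq (Finset.sum_congr rfl fun t ht => ?_)) key
  congr 2
  refine PiLp.ext fun i => ?_
  change hadamardSeq p'.toReal (y i : ℕ → 𝕜) t = _
  rw [hadamardSeq_eq_sum _ _ (Finset.mem_range.1 ht)]
  simp [coordVec]

theorem isFSS_hadamardOp : IsFSS (hadamardOp hpp' hp2 : Ell 𝕜 p →L[𝕜] Ell 𝕜 p') := by
  intro ε hε
  have hr0 := hpp'.pos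
  have hr'0 := hpp'.symm.pos
  have hmul := hpp'.mul_eq_add
  have hp'2 : 2 < p'.toReal := by nlinarith [hpp'.symm.lt]
  have hp2' : p < 2 := by
    refine (ENNReal.toReal_lt_toReal ?_ (by norm_num)).1 (by simpa using hp2)
    intro h; simp [h] at hr0
  obtain ⟨C, hC, hCn⟩ := exists_sum_norm_signSum_rpow_le 𝕜 hr'0
  set r := p.toReal with hr
  set r' := p'.toReal with hr'
  -- If H is bounded below by ε on E, then η is a lower bound for the sign average of ‖∑ ± H y_i‖^r,
  -- by the lower Khintchine inequality.
  set η := ε ^ r * 2 ^ (r - 4) with hη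
  have hη0 : 0 < η := by positivity
  set δ := (η / 2) ^ (1 / r) with hδ
  have hδ0 : 0 < δ := by positivity
  have hδr : δ ^ r = η / 2 := by
    rw [hδ, ← Real.rpow_mul (by positivity), one_div_mul_cancel hr0.ne', Real.rpow_one]
  have hlim : Filter.Tendsto (fun n : ℕ => δ ^ (r - r') * (C * (2 / √n) ^ (r' - 2)))
      Filter.atTop (𝓝 0) := by
    have h1 : Filter.Tendsto (fun n : ℕ => (2 : ℝ) / √n) Filter.atTop (𝓝 0) :=
      Filter.Tendsto.const_div_atTop
        (Real.tendsto_sqrt_atTop.comp tendsto_natCast_atTop_atTop) 2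
    have h2 := h1.rpow_const (p := r' - 2) (Or.inr (by linarith))
    rw [Real.zero_rpow (by linarith)] at h2
    simpa using (h2.const_mul C).const_mul (δ ^ (r - r'))
  obtain ⟨n, hn1, hn2⟩ := ((Filter.eventually_ge_atTop 1).and
    (hlim.eventually_lt_const (by positivity : 0 < η / 2))).exists
  refine ⟨n, hn1, fun E hE => ?_⟩
  by_contra! hcon
  obtain ⟨y, hyE, hy1, hyQ⟩ := exists_well_conditioned_family hp2' hn1 E hE
  have hR := squareEnergy_hadamardOp_le hpp' hp2 y hy1 hyQ
  have hlow := le_sum_norm_signSum_rpow hr0 hp2 y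
  have hup := hCn n (fun i => hadamardOp hpp' hp2 (y i))
  rw [hy1, mul_one] at hlow
  -- Passage from exponent p to the larger p': values below δ contribute at most δ^r = η/2 to the
  -- average, and larger ones are controlled by the p'-th moment, which tends to 0 with n.
  have hpt : ∀ a : ℝ, 0 ≤ a → a ^ r ≤ δ ^ r + δ ^ (r - r') * a ^ r' := by
    intro a ha
    rcases le_or_gt a δ with h | h
    · have := Real.rpow_le_rpow ha h hr0.le
      have : 0 ≤ δ ^ (r - r') * a ^ r' := by positivity
      linarith
    · have h1 : a ^ r = a ^ (r - r') * a ^ r' := by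
        rw [← Real.rpow_add (hδ0.trans h)]; ring_nf
      have h2 : a ^ (r - r') ≤ δ ^ (r - r') :=
        Real.rpow_le_rpow_of_nonpos hδ0 h.le (by linarith)
      have h3 : a ^ (r - r') * a ^ r' ≤ δ ^ (r - r') * a ^ r' := by gcongr
      have : 0 ≤ δ ^ r := by positivity
      linarith
  have hσ : ∀ σ : Fin n → Bool, ε ^ r * ‖signSum σ y‖ ^ r ≤
      δ ^ r + δ ^ (r - r') * ‖signSum σ (fun i => hadamardOp hpp' hp2 (y i))‖ ^ r' := by
    intro σ
    have hmem : signSum σ y ∈ E := by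
      refine Submodule.sum_mem _ fun i _ => ?_
      split_ifs
      · exact hyE i
      · exact E.neg_mem (hyE i)
    have h1 := hcon _ hmem
    have h2 : hadamardOp hpp' hp2 (signSum σ y) =
        signSum σ (fun i => hadamardOp hpp' hp2 (y i)) :=
      map_signSum ((hadamardOp hpp' hp2 : Ell 𝕜 p →L[𝕜] Ell 𝕜 p') :
        Ell 𝕜 p →+ Ell 𝕜 p') σ y
    rw [h2] at h1
    rw [← Real.mul_rpow hε.le (norm_nonneg _)]
    exact (Real.rpow_le_rpow (by positivity) h1 hr0.le).trans (hpt _ (norm_nonneg _))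
  have hsum := Finset.sum_le_sum fun σ (_ : σ ∈ (Finset.univ : Finset (Fin n → Bool))) => hσ σ
  rw [← Finset.mul_sum, Finset.sum_add_distrib, ← Finset.mul_sum] at hsum
  simp only [Finset.sum_const, Finset.card_univ, Fintype.card_fun, Fintype.card_bool,
    Fintype.card_fin, nsmul_eq_mul] at hsum
  push_cast at hsum
  have h2n : (0 : ℝ) < 2 ^ n := by positivity
  have h1 : η * 2 ^ n ≤ 2 ^ n * (η / 2) + δ ^ (r - r') * (C * (2 / √n) ^ (r' - 2) * 2 ^ n) := by
    calc η * 2 ^ n = ε ^ r * (2 ^ (r - 4) * 2 ^ n) := by rw [hη]; ring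
      _ ≤ ε ^ r * ∑ σ : Fin n → Bool, ‖signSum σ y‖ ^ r := by gcongr
      _ ≤ _ := hsum
      _ ≤ _ := by
        rw [hδr]
        gcongr
        exact hup.trans (by gcongr)
  nlinarith

end FinitelyStrictlySingular

/-! ### Finitely strictly singular and superstrictly cosingular operators -/

section OperatorIdeals

variable {𝕜 : Type*} [RCLike 𝕜]
  {X X' Y Y' : Type*} [NormedAddCommGroup X] [NormedSpace 𝕜 X]
  [NormedAddCommGroup X'] [NormedSpace 𝕜 X'] [NormedAddCommGroup Y] [NormedSpace 𝕜 Y]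
  [NormedAddCommGroup Y'] [NormedSpace 𝕜 Y']

/-- If B is injective on E, apply the hypothesis to B(E), which has the same dimension; otherwise T
kills a nonzero vector of E. Domination in norm, without a factorisation, is what the adjoint
arguments need. -/
theorem IsFSS.of_norm_le {S : X' →L[𝕜] Y'} (hS : IsFSS S) (T : X →L[𝕜] Y) (B : X →L[𝕜] X')
    (C : ℝ) (hT : ∀ x, ‖T x‖ ≤ C * ‖S (B x)‖) : IsFSS T := by
  intro ε hε
  have hC : 0 < |C| + 1 := by positivity
  have hB : 0 < ‖B‖ + 1 := by positivity
  obtain ⟨n, hn, h⟩ := hS (ε / ((|C| + 1) * (‖B‖ + 1))) (by positivity)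
  refine ⟨n, hn, fun E hE => ?_⟩
  by_cases hinj : ∀ x ∈ E, B x = 0 → x = 0
  · have hfin : FiniteDimensional 𝕜 E := FiniteDimensional.of_finrank_pos (by omega)
    have hrank : Module.finrank 𝕜 (LinearMap.range ((B : X →ₗ[𝕜] X').domRestrict E)) = n := by
      rw [← hE]
      refine LinearMap.finrank_range_of_inj ((injective_iff_map_eq_zero _).2 fun x hx => ?_)
      exact Subtype.ext (hinj x x.2 hx)
    obtain ⟨_, ⟨⟨x, hx⟩, rfl⟩, hlt⟩ := h _ hrank
    refine ⟨x, hx, ?_⟩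
    change ‖S (B x)‖ < _ * ‖B x‖ at hlt
    calc ‖T x‖ ≤ C * ‖S (B x)‖ := hT x
      _ ≤ (|C| + 1) * ‖S (B x)‖ := by gcongr; linarith [le_abs_self C]
      _ < (|C| + 1) * (ε / ((|C| + 1) * (‖B‖ + 1)) * ‖B x‖) := by gcongr
      _ ≤ (|C| + 1) * (ε / ((|C| + 1) * (‖B‖ + 1)) * ((‖B‖ + 1) * ‖x‖)) := by
        gcongr
        exact (B.le_opNorm x).trans (by gcongr; linarith)
      _ = ε * ‖x‖ := by field_simp
  · push Not at hinj
    obtain ⟨x, hx, hBx, hx0⟩ := hinj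
    refine ⟨x, hx, ?_⟩
    have := hT x
    rw [hBx, map_zero, norm_zero, mul_zero] at this
    have : 0 < ‖x‖ := norm_pos_iff.2 hx0
    have : 0 < ε * ‖x‖ := by positivity
    linarith

theorem IsFSS.comp_left {T : X →L[𝕜] Y} (hT : IsFSS T) (A : Y →L[𝕜] Y') : IsFSS (A.comp T) :=
  hT.of_norm_le _ (ContinuousLinearMap.id 𝕜 X) ‖A‖ fun x => A.le_opNorm (T x)

theorem IsFSS.comp_right {T : X →L[𝕜] Y} (hT : IsFSS T) (B : X' →L[𝕜] X) : IsFSS (T.comp B) :=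
  hT.of_norm_le _ B 1 fun x => (one_mul ‖T (B x)‖).ge

/-- A larger subspace contains one of dimension n. This makes a single n serve for all later a_m. -/
theorem exists_norm_lt_of_le_finrank {T : X →L[𝕜] Y} {ε : ℝ} {n : ℕ}
    (h : ∀ E : Submodule 𝕜 X, Module.finrank 𝕜 E = n → ∃ x ∈ E, ‖T x‖ < ε * ‖x‖)
    (E : Submodule 𝕜 X) (hn : n ≤ Module.finrank 𝕜 E) : ∃ x ∈ E, ‖T x‖ < ε * ‖x‖ := by
  obtain ⟨f, hf⟩ := exists_linearIndependent_of_le_finrank hn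
  have hf' : LinearIndependent 𝕜 fun i => (f i : X) := hf.map' E.subtype E.ker_subtype
  have hrank : Module.finrank 𝕜 (Submodule.span 𝕜 (Set.range fun i => (f i : X))) = n := by
    rw [finrank_span_eq_card hf', Fintype.card_fin]
  obtain ⟨x, hx, hlt⟩ := h _ hrank
  refine ⟨x, Submodule.span_le.2 ?_ hx, hlt⟩
  rintro _ ⟨i, rfl⟩
  exact (f i).2

/-- The (Banach space) adjoint of an operator. -/
noncomputable def dualOp (T : X →L[𝕜] Y) : StrongDual 𝕜 Y →L[𝕜] StrongDual 𝕜 X :=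
  T.precomp 𝕜

/-- An operator is superstrictly cosingular if its adjoint is finitely strictly singular. -/
theorem IsFSS.isSSCS_of_dualOp {T : X →L[𝕜] Y} (h : IsFSS (dualOp T)) : IsSSCS T := by
  rw [IsSSCS, ENNReal.tendsto_nhds_zero]
  intro δ hδ
  obtain ⟨ε, hε0, hεδ⟩ : ∃ ε : ℝ≥0, 0 < ε ∧ (ε : ℝ≥0∞) ≤ δ := by
    obtain ⟨ε, h1, h2⟩ := ENNReal.lt_iff_exists_nnreal_btwn.1 hδ
    exact ⟨ε, by exact_mod_cast h1, h2.le⟩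
  obtain ⟨n, hn, hfss⟩ := h ε (by exact_mod_cast hε0)
  filter_upwards [Filter.eventually_ge_atTop n] with m hm
  refine iSup_le fun E => iSup_le fun hEc => iSup_le fun hEm => iSup_le fun r => iSup_le fun hr => ?_
  refine le_trans ?_ hεδ
  rw [ENNReal.coe_le_coe]
  by_contra! hrε
  have hr0 : 0 < (r : ℝ) := by exact_mod_cast hε0.trans hrε
  have : IsClosed (E : Set Y) := hEc
  -- Here m ≥ n ≥ 1 matters: `finrank` has default value 0 on infinite-dimensional spaces.
  have hfin : FiniteDimensional 𝕜 (Y ⧸ E) := FiniteDimensional.of_finrank_pos (by omega)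
  -- The dual of Y/E embeds in Y* as the m-dimensional annihilator of E. A ball of radius r in the
  -- image of the unit ball bounds T* below by r on it, contradicting the choice of n if r > ε.
  let π : StrongDual 𝕜 (Y ⧸ E) →L[𝕜] StrongDual 𝕜 Y := dualOp E.mkQL
  have hπ : Function.Injective π := by
    intro f g hfg
    ext y
    obtain ⟨y, rfl⟩ := Submodule.Quotient.mk_surjective E y
    exact DFunLike.congr_fun hfg y
  have hrank : Module.finrank 𝕜 (LinearMap.range π.toLinearMap) = m := by
    rw [LinearMap.finrank_range_of_inj hπ, ← hEm]
    rw [← (LinearMap.toContinuousLinearMap : ((Y ⧸ E) →ₗ[𝕜] 𝕜) ≃ₗ[𝕜] _).finrank_eq]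
    exact Subspace.dual_finrank_eq
  obtain ⟨_, ⟨f, rfl⟩, hf⟩ := exists_norm_lt_of_le_finrank hfss _ (hm.trans_eq hrank.symm)
  change ‖(π f).comp T‖ < ε * ‖π f‖ at hf
  have hbound : ‖π f‖ ≤ ‖(π f).comp T‖ / r := by
    refine ContinuousLinearMap.opNorm_le_of_unit_norm (by positivity) fun y hy => ?_
    have hball : ((r : ℝ) : 𝕜) • (Submodule.Quotient.mk y : Y ⧸ E) ∈
        Metric.closedBall (0 : Y ⧸ E) (r : ℝ) := by
      rw [mem_closedBall_zero_iff, norm_smul, RCLike.norm_ofReal, abs_of_pos hr0]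
      have : ‖(Submodule.Quotient.mk y : Y ⧸ E)‖ ≤ 1 := by
        rw [← hy]; exact Submodule.Quotient.norm_mk_le E y
      nlinarith
    obtain ⟨x, hx, hxy⟩ := hr hball
    have h1 : ((r : ℝ) : 𝕜) * π f y = π f (T x) := by
      have := congrArg f hxy
      rw [map_smul] at this
      exact this.symm
    rw [le_div_iff₀ hr0, mul_comm]
    calc (r : ℝ) * ‖π f y‖ = ‖((r : ℝ) : 𝕜) * π f y‖ := by
          rw [norm_mul, RCLike.norm_ofReal, abs_of_pos hr0]
      _ = ‖((π f).comp T) x‖ := by rw [h1]; rfl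
      _ ≤ ‖(π f).comp T‖ * ‖x‖ := ContinuousLinearMap.le_opNorm _ _
      _ ≤ ‖(π f).comp T‖ := by
        rw [mem_closedBall_zero_iff] at hx
        exact mul_le_of_le_one_right (norm_nonneg _) hx
  rw [le_div_iff₀ hr0] at hbound
  have h2 : (ε : ℝ) * ‖π f‖ ≤ ‖π f‖ * r := by
    rw [mul_comm]
    gcongr
  linarith

end OperatorIdeals

/-! ### The adjoint of the Hadamard operator -/

section HadamardAdjoint

theorem lp_single_eq_smul {𝕜 : Type*} [RCLike 𝕜] (p : ℝ≥0∞) (j : ℕ) (c : 𝕜) :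
    (lp.single p j c : Ell 𝕜 p) = c • lp.single p j (1 : 𝕜) := by
  rw [← lp.single_smul, smul_eq_mul, mul_one]

variable {𝕜 : Type*} [RCLike 𝕜] {p p' : ℝ≥0∞} [Fact (1 ≤ p')]

/-- With a_i = φ(e_i), evaluate φ at the finite sum of |a_i|^(p-2) conj(a_i) e_i: this gives W ≤ ‖φ‖
W^(1/p') for W = ∑ |a_i|^p. -/
theorem sum_norm_apply_single_rpow_le (hpp' : p.toReal.HolderConjugate p'.toReal)
    (φ : StrongDual 𝕜 (Ell 𝕜 p')) (s : Finset ℕ) :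
    ∑ i ∈ s, ‖φ (lp.single p' i 1)‖ ^ p.toReal ≤ ‖φ‖ ^ p.toReal := by
  have hr0 := hpp'.pos
  have hr'0 := hpp'.symm.pos
  have hmul := hpp'.mul_eq_add
  set r := p.toReal
  set r' := p'.toReal with hr'
  let a : ℕ → 𝕜 := fun i => φ (lp.single p' i 1)
  let c : ℕ → 𝕜 := fun i => ((‖a i‖ ^ (r - 2) : ℝ) : 𝕜) * (starRingEnd 𝕜) (a i)
  set W := ∑ i ∈ s, ‖a i‖ ^ r
  change W ≤ _
  have hW0 : 0 ≤ W := Finset.sum_nonneg fun _ _ => by positivity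
  rcases hW0.eq_or_lt with h0 | hWpos
  · rw [← h0]; positivity
  have hc : ∀ i, ‖c i‖ ^ r' = ‖a i‖ ^ r := by
    intro i
    rcases (norm_nonneg (a i)).eq_or_lt with h | h
    · have h1 : a i = 0 := norm_eq_zero.1 h.symm
      simp [c, h1, Real.zero_rpow hr'0.ne', Real.zero_rpow hr0.ne']
    · rw [norm_mul, RCLike.norm_ofReal, RCLike.norm_conj, abs_of_pos (by positivity),
        ← Real.rpow_add_one h.ne', ← Real.rpow_mul h.le]
      congr 1; linear_combination hmul
  have hca : ∀ i, c i * a i = ((‖a i‖ ^ r : ℝ) : 𝕜) := by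
    intro i
    rcases (norm_nonneg (a i)).eq_or_lt with h | h
    · have h1 : a i = 0 := norm_eq_zero.1 h.symm
      simp [h1, Real.zero_rpow hr0.ne']
    · simp only [c]
      rw [mul_assoc, RCLike.conj_mul, ← RCLike.ofReal_pow, ← RCLike.ofReal_mul,
        ← Real.rpow_natCast, ← Real.rpow_add h]
      norm_num
  have hz : ‖∑ i ∈ s, lp.single p' i (c i)‖ ^ r' = W := by
    rw [lp.norm_sum_single hr'0]
    exact Finset.sum_congr rfl fun i _ => hc i
  have hφ : φ (∑ i ∈ s, lp.single p' i (c i)) = (W : 𝕜) := by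
    rw [map_sum, RCLike.ofReal_sum]
    refine Finset.sum_congr rfl fun i _ => ?_
    rw [← hca, lp_single_eq_smul, map_smul, smul_eq_mul]
  have h1 := φ.le_opNorm (∑ i ∈ s, lp.single p' i (c i))
  rw [hφ, RCLike.norm_ofReal, abs_of_pos hWpos] at h1
  have h2 := Real.rpow_le_rpow hW0 h1 hr'0.le
  rw [Real.mul_rpow (norm_nonneg _) (norm_nonneg _), hz] at h2
  have h3 : W ^ r' = W ^ (r' - 1) * W := by
    rw [← Real.rpow_add_one hWpos.ne', sub_add_cancel]
  rw [h3] at h2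
  have h4 := le_of_mul_le_mul_right h2 hWpos
  have hr'1 : 0 < r' - 1 := by linarith [hpp'.symm.lt]
  have h5 := Real.rpow_le_rpow (by positivity) h4 (by positivity : 0 ≤ 1 / (r' - 1))
  rw [← Real.rpow_mul hW0, ← Real.rpow_mul (norm_nonneg _), mul_one_div_cancel hr'1.ne',
    Real.rpow_one] at h5
  refine h5.trans_eq ?_
  congr 1
  rw [mul_one_div, div_eq_iff hr'1.ne']
  linear_combination -hmul

variable [Fact (1 ≤ p)]

/-- The operator that maps a functional on `ℓ_p'` to the sequence of its values at the unit
vectors. -/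
noncomputable def dualSeq (hpp' : p.toReal.HolderConjugate p'.toReal) :
    StrongDual 𝕜 (Ell 𝕜 p') →L[𝕜] Ell 𝕜 p :=
  LinearMap.mkContinuous
    { toFun := fun φ => ⟨fun i => φ (lp.single p' i 1),
        memℓp_gen' (sum_norm_apply_single_rpow_le hpp' φ)⟩
      map_add' := fun _ _ => rfl
      map_smul' := fun _ _ => rfl } 1
    (fun φ => by
      rw [one_mul]
      exact lp.norm_le_of_forall_sum_le hpp'.pos (norm_nonneg _)
        (sum_norm_apply_single_rpow_le hpp' φ))

theorem dualSeq_apply (hpp' : p.toReal.HolderConjugate p'.toReal) (φ : StrongDual 𝕜 (Ell 𝕜 p'))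
    (i : ℕ) : dualSeq hpp' φ i = φ (lp.single p' i 1) := rfl

/-- Symmetry of the matrix: the values of H*φ at the unit vectors form H applied to the sequence of
φ. -/
theorem apply_hadamardOp_single (hpp' : p.toReal.HolderConjugate p'.toReal)
    (hp2 : p.toReal < 2) (φ : StrongDual 𝕜 (Ell 𝕜 p')) (j : ℕ) :
    φ (hadamardOp hpp' hp2 (lp.single p j 1)) = hadamardOp hpp' hp2 (dualSeq hpp' φ) j := by
  have h1 : hadamardOp hpp' hp2 (lp.single p j (1 : 𝕜)) = ∑ i ∈ Finset.range (2 * j + 1),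
      ((hadamardSumEntry p'.toReal i j : ℝ) : 𝕜) • lp.single p' i (1 : 𝕜) := by
    refine lp.ext (funext fun k => ?_)
    rw [hadamardOp_single, lp.coeFn_sum, Finset.sum_apply]
    simp only [lp.coeFn_smul, Pi.smul_apply, smul_eq_mul]
    rw [Finset.sum_eq_single k]
    · rw [lp.single_apply_self, mul_one]
    · intro l _ hl
      rw [lp.single_apply_ne p' l _ (Ne.symm hl), mul_zero]
    · intro hk
      rw [hadamardSumEntry_comm, hadamardSumEntry_eq_zero_of_le _ (by simpa using hk)]; simp
  rw [h1, map_sum, hadamardOp_apply, hadamardSeq]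
  refine Finset.sum_congr rfl fun i _ => ?_
  rw [map_smul, smul_eq_mul, hadamardSumEntry_comm, dualSeq_apply]

/-- Hölder gives ‖H*φ‖ ≤ ‖H(`dualSeq` φ)‖, so domination suffices and the dual of ℓ_p' need not be
identified with ℓ_p. -/
theorem isFSS_dualOp_hadamardOp (hpp' : p.toReal.HolderConjugate p'.toReal)
    (hp2 : p.toReal < 2) :
    IsFSS (dualOp (hadamardOp hpp' hp2 : Ell 𝕜 p →L[𝕜] Ell 𝕜 p')) := by
  refine (isFSS_hadamardOp (𝕜 := 𝕜) hpp' hp2).of_norm_le _ (dualSeq hpp') 1 fun φ => ?_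
  rw [one_mul]
  refine ContinuousLinearMap.opNorm_le_bound _ (norm_nonneg _) fun z => ?_
  have hp : p ≠ ∞ := by
    intro h
    have := hpp'.pos
    simp [h] at this
  set w := hadamardOp hpp' hp2 (dualSeq hpp' φ)
  have h1 : HasSum (fun j => z j * w j) (φ (hadamardOp hpp' hp2 z)) := by
    have := ((lp.hasSum_single hp z).mapL (hadamardOp hpp' hp2)).mapL φ
    refine this.congr_fun fun j => ?_
    rw [lp_single_eq_smul, map_smul, map_smul, smul_eq_mul,
      apply_hadamardOp_single]
  have h2 := lp.tsum_mul_le_mul_norm hpp' z w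
  change ‖φ (hadamardOp hpp' hp2 z)‖ ≤ ‖w‖ * ‖z‖
  rw [← h1.tsum_eq, mul_comm]
  simp_rw [← norm_mul] at h2
  exact (norm_tsum_le_tsum_norm h2.1).trans h2.2

end HadamardAdjoint

/-! ### Operators outside the closed span of the operators that factor through `ℓ₂` -/

section HadamardForm

variable {𝕜 : Type*} [RCLike 𝕜]
  {X Y : Type*} [NormedAddCommGroup X] [NormedSpace 𝕜 X]
  [NormedAddCommGroup Y] [NormedSpace 𝕜 Y]

/-- The trace-duality pairing of an operator with the `n`-th Hadamard matrix, relative to a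
sequence of vectors and a sequence of functionals. -/
noncomputable def hadamardForm (z : ℕ → X) (g : ℕ → StrongDual 𝕜 Y) (n : ℕ) (T : X →L[𝕜] Y) : 𝕜 :=
  ∑ t ∈ Finset.range (2 ^ n), ∑ j ∈ Finset.range (2 ^ n),
    ((hadamardEntry n t j : ℝ) : 𝕜) * g (2 ^ n - 1 + t) (T (z (2 ^ n - 1 + j)))

theorem hadamardForm_add (z : ℕ → X) (g : ℕ → StrongDual 𝕜 Y) (n : ℕ) (S T : X →L[𝕜] Y) :
    hadamardForm z g n (S + T) = hadamardForm z g n S + hadamardForm z g n T := by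
  simp [hadamardForm, mul_add, Finset.sum_add_distrib]

theorem hadamardForm_smul (z : ℕ → X) (g : ℕ → StrongDual 𝕜 Y) (n : ℕ) (c : 𝕜) (T : X →L[𝕜] Y) :
    hadamardForm z g n (c • T) = c * hadamardForm z g n T := by
  simp [hadamardForm, Finset.mul_sum, mul_left_comm]

/-- Orthogonality in ℓ₂ gives ∑ₜ ‖∑ⱼ hₜⱼ vⱼ‖² = N ∑ ‖vⱼ‖² = O(N²); Cauchy–Schwarz over the N values
of t adds a factor √N, hence N^(3/2). -/
theorem norm_hadamardForm_comp_le {z : ℕ → X} {g : ℕ → StrongDual 𝕜 Y} {C : ℝ}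
    (hz : ∀ i, ‖z i‖ ≤ C) (hg : ∀ i, ‖g i‖ ≤ C) (n : ℕ)
    (A : Ell 𝕜 2 →L[𝕜] Y) (B : X →L[𝕜] Ell 𝕜 2) :
    ‖hadamardForm z g n (A.comp B)‖ ≤ C * ‖A‖ * (C * ‖B‖) * ((2 : ℝ) ^ n) ^ (3 / 2 : ℝ) := by
  have hC : 0 ≤ C := (norm_nonneg _).trans (hz 0)
  set N : ℝ := (2 : ℝ) ^ n with hN
  have hN0 : 0 < N := by positivity
  set s := Finset.range (2 ^ n) with hs
  let v : ℕ → Ell 𝕜 2 := fun j => B (z (2 ^ n - 1 + j))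
  have hv : ∀ j, ‖v j‖ ≤ C * ‖B‖ := fun j =>
    (B.le_opNorm _).trans (by rw [mul_comm]; gcongr; exact hz _)
  have h1 : hadamardForm z g n (A.comp B) =
      ∑ t ∈ s, g (2 ^ n - 1 + t) (A (∑ j ∈ s, hadamardEntry n t j • v j)) := by
    refine Finset.sum_congr rfl fun t _ => ?_
    rw [map_sum, map_sum]
    refine Finset.sum_congr rfl fun j _ => ?_
    rw [RCLike.real_smul_eq_coe_smul (K := 𝕜), map_smul, map_smul, smul_eq_mul]
    rfl
  have h2 : ∑ t ∈ s, ‖∑ j ∈ s, hadamardEntry n t j • v j‖ ^ 2 = ∑ j ∈ s, N * ‖v j‖ ^ 2 :=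
    sum_norm_sq_smul_of_orthogonal s (hadamardEntry n) (fun _ => N) (fun j hj l hl =>
      sum_hadamardEntry_mul n (Finset.mem_range.1 hj) (Finset.mem_range.1 hl)) v
  have hcard : (s.card : ℝ) = N := by simp [hs, hN]
  have h3 : ∑ t ∈ s, ‖∑ j ∈ s, hadamardEntry n t j • v j‖ ≤ N ^ (3 / 2 : ℝ) * (C * ‖B‖) := by
    have h4 := Real.sum_mul_le_sqrt_mul_sqrt s (fun _ => (1 : ℝ))
      (fun t => ‖∑ j ∈ s, hadamardEntry n t j • v j‖)
    simp only [one_mul, one_pow, Finset.sum_const, nsmul_eq_mul, mul_one] at h4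
    rw [h2, hcard] at h4
    have h5 : ∑ j ∈ s, N * ‖v j‖ ^ 2 ≤ (N * (C * ‖B‖)) ^ 2 := by
      calc ∑ j ∈ s, N * ‖v j‖ ^ 2 ≤ ∑ j ∈ s, N * (C * ‖B‖) ^ 2 := by
            gcongr with j _
            exact hv j
        _ = _ := by rw [Finset.sum_const, nsmul_eq_mul, hcard]; ring
    refine h4.trans ?_
    calc √N * √(∑ j ∈ s, N * ‖v j‖ ^ 2) ≤ √N * √((N * (C * ‖B‖)) ^ 2) := by gcongr
      _ = √N * N * (C * ‖B‖) := by rw [Real.sqrt_sq (by positivity), mul_assoc]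
      _ = _ := by
        rw [Real.sqrt_eq_rpow, ← Real.rpow_add_one hN0.ne']
        norm_num
  rw [h1]
  calc _ ≤ ∑ t ∈ s, C * ‖A‖ * ‖∑ j ∈ s, hadamardEntry n t j • v j‖ := by
        refine (norm_sum_le _ _).trans (Finset.sum_le_sum fun t _ => ?_)
        refine (ContinuousLinearMap.le_opNorm _ _).trans ?_
        rw [mul_assoc]
        gcongr
        · exact hg _
        · exact A.le_opNorm _
    _ ≤ C * ‖A‖ * (N ^ (3 / 2 : ℝ) * (C * ‖B‖)) := by rw [← Finset.mul_sum]; gcongr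
    _ = _ := by ring

theorem tendsto_hadamardForm_of_mem_span {z : ℕ → X} {g : ℕ → StrongDual 𝕜 Y} {C r : ℝ}
    (hr0 : 0 < r) (hr2 : r < 2) (hz : ∀ i, ‖z i‖ ≤ C) (hg : ∀ i, ‖g i‖ ≤ C) {T : X →L[𝕜] Y}
    (hT : T ∈ Submodule.span 𝕜 (factorsThrough 𝕜 (Ell 𝕜 2) X Y)) :
    Filter.Tendsto (fun n => ‖hadamardForm z g n T‖ / ((2 : ℝ) ^ n) ^ (1 + 1 / r))
      Filter.atTop (𝓝 0) := by
  induction hT using Submodule.span_induction with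
  | mem T hT =>
    obtain ⟨A, B, rfl⟩ := hT
    have h1 : ∀ n : ℕ, ‖hadamardForm z g n (A.comp B)‖ / ((2 : ℝ) ^ n) ^ (1 + 1 / r) ≤
        C * ‖A‖ * (C * ‖B‖) * ((2 : ℝ) ^ (1 / 2 - 1 / r)) ^ n := by
      intro n
      have h2n : (0 : ℝ) < 2 ^ n := by positivity
      rw [div_le_iff₀ (by positivity)]
      refine (norm_hadamardForm_comp_le hz hg n A B).trans_eq ?_
      rw [mul_assoc (C * ‖A‖ * (C * ‖B‖))]
      congr 1
      rw [← Real.rpow_natCast (2 ^ (1 / 2 - 1 / r)) n, ← Real.rpow_mul two_pos.le,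
        mul_comm _ (n : ℝ), Real.rpow_mul two_pos.le, Real.rpow_natCast, ← Real.rpow_add h2n]
      congr 1; ring
    have h2 : (2 : ℝ) ^ (1 / 2 - 1 / r) < 1 := by
      refine Real.rpow_lt_one_of_one_lt_of_neg one_lt_two ?_
      have : 1 / 2 < 1 / r := one_div_lt_one_div_of_lt hr0 hr2
      linarith
    have h3 := (tendsto_pow_atTop_nhds_zero_of_lt_one (by positivity) h2).const_mul
      (C * ‖A‖ * (C * ‖B‖))
    rw [mul_zero] at h3
    exact squeeze_zero (fun n => by positivity) h1 h3
  | zero => simp [hadamardForm]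
  | add S T _ _ hS hT =>
    have h := hS.add hT
    rw [add_zero] at h
    refine squeeze_zero (fun n => by positivity) (fun n => ?_) h
    rw [hadamardForm_add, ← add_div]
    gcongr
    exact norm_add_le _ _
  | smul c T _ hT =>
    have h := hT.const_mul ‖c‖
    rw [mul_zero] at h
    refine h.congr fun n => ?_
    rw [hadamardForm_smul, norm_mul, mul_div_assoc]

/-- The normalised forms are equicontinuous and tend to 0 on the span, but keep modulus 1 at T. -/
theorem notMem_closedSpanG2 {z : ℕ → X} {g : ℕ → StrongDual 𝕜 Y} {C M r : ℝ}
    (hr0 : 0 < r) (hr2 : r < 2) (hz : ∀ i, ‖z i‖ ≤ C) (hg : ∀ i, ‖g i‖ ≤ C)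
    (hM : ∀ (n : ℕ) (T : X →L[𝕜] Y),
      ‖hadamardForm z g n T‖ ≤ M * ((2 : ℝ) ^ n) ^ (1 + 1 / r) * ‖T‖) {T : X →L[𝕜] Y}
    (hT : ∀ n, ‖hadamardForm z g n T‖ = ((2 : ℝ) ^ n) ^ (1 + 1 / r)) :
    T ∉ closedSpanG2 𝕜 X Y := by
  intro hmem
  have hcl : T ∈ closure ((Submodule.span 𝕜 (factorsThrough 𝕜 (Ell 𝕜 2) X Y) :
    Submodule 𝕜 (X →L[𝕜] Y)) : Set (X →L[𝕜] Y)) := hmem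
  -- An approximant this close changes the form by at most w/2; |M| + 1 keeps the denominator
  -- positive.
  obtain ⟨S, hS, hdist⟩ := Metric.mem_closure_iff.1 hcl (1 / (2 * (|M| + 1))) (by positivity)
  obtain ⟨n, hn⟩ := ((tendsto_hadamardForm_of_mem_span hr0 hr2 hz hg hS).eventually_lt_const
    (by norm_num : (0 : ℝ) < 1 / 2)).exists
  set w := ((2 : ℝ) ^ n) ^ (1 + 1 / r)
  have hw : 0 < w := by positivity
  rw [div_lt_iff₀ hw] at hn
  have h1 : hadamardForm z g n T = hadamardForm z g n (T - S) + hadamardForm z g n S := by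
    rw [← hadamardForm_add, sub_add_cancel]
  have h2 := norm_add_le (hadamardForm z g n (T - S)) (hadamardForm z g n S)
  rw [← h1, hT] at h2
  have h3 := hM n (T - S)
  rw [dist_eq_norm] at hdist
  have h4 : M * w * ‖T - S‖ ≤ 1 / 2 * w := by
    calc M * w * ‖T - S‖ ≤ (|M| + 1) * w * (1 / (2 * (|M| + 1))) := by
          gcongr
          linarith [le_abs_self M]
      _ = 1 / 2 * w := by field_simp
  linarith

/-- The j-sum is moved onto the vectors, which suits T itself. The companion
`norm_hadamardForm_le_of_right` moves the t-sum onto the functionals, as needed for adjoints. -/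
theorem norm_hadamardForm_le_of_left {z : ℕ → X} {g : ℕ → StrongDual 𝕜 Y} {C M r : ℝ}
    (hg : ∀ i, ‖g i‖ ≤ C)
    (hz : ∀ n t, ‖∑ j ∈ Finset.range (2 ^ n), ((hadamardEntry n t j : ℝ) : 𝕜) •
      z (2 ^ n - 1 + j)‖ ≤ M * ((2 : ℝ) ^ n) ^ (1 / r)) (n : ℕ) (T : X →L[𝕜] Y) :
    ‖hadamardForm z g n T‖ ≤ C * M * ((2 : ℝ) ^ n) ^ (1 + 1 / r) * ‖T‖ := by
  have hC : 0 ≤ C := (norm_nonneg _).trans (hg 0)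
  have h1 : hadamardForm z g n T = ∑ t ∈ Finset.range (2 ^ n), g (2 ^ n - 1 + t)
      (T (∑ j ∈ Finset.range (2 ^ n), ((hadamardEntry n t j : ℝ) : 𝕜) • z (2 ^ n - 1 + j))) := by
    refine Finset.sum_congr rfl fun t _ => ?_
    rw [map_sum, map_sum]
    refine Finset.sum_congr rfl fun j _ => ?_
    rw [map_smul, map_smul, smul_eq_mul]
  rw [h1]
  calc _ ≤ ∑ t ∈ Finset.range (2 ^ n), C * (‖T‖ * (M * ((2 : ℝ) ^ n) ^ (1 / r))) := by
        refine (norm_sum_le _ _).trans (Finset.sum_le_sum fun t _ => ?_)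
        refine (ContinuousLinearMap.le_opNorm _ _).trans ?_
        gcongr
        · exact hg _
        · exact (T.le_opNorm _).trans (by gcongr; exact hz n t)
    _ = _ := by
      rw [Finset.sum_const, Finset.card_range, nsmul_eq_mul, Real.rpow_add (by positivity),
        Real.rpow_one]
      push_cast
      ring

theorem norm_hadamardForm_le_of_right {z : ℕ → X} {g : ℕ → StrongDual 𝕜 Y} {C M r : ℝ}
    (hz : ∀ i, ‖z i‖ ≤ C)
    (hg : ∀ n t, ‖∑ j ∈ Finset.range (2 ^ n), ((hadamardEntry n t j : ℝ) : 𝕜) •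
      g (2 ^ n - 1 + j)‖ ≤ M * ((2 : ℝ) ^ n) ^ (1 / r)) (n : ℕ) (T : X →L[𝕜] Y) :
    ‖hadamardForm z g n T‖ ≤ C * M * ((2 : ℝ) ^ n) ^ (1 + 1 / r) * ‖T‖ := by
  have hC : 0 ≤ C := (norm_nonneg _).trans (hz 0)
  have hM : 0 ≤ M * ((2 : ℝ) ^ n) ^ (1 / r) := (norm_nonneg _).trans (hg n 0)
  have h1 : hadamardForm z g n T = ∑ j ∈ Finset.range (2 ^ n),
      (∑ t ∈ Finset.range (2 ^ n), ((hadamardEntry n j t : ℝ) : 𝕜) • g (2 ^ n - 1 + t))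
        (T (z (2 ^ n - 1 + j))) := by
    rw [hadamardForm, Finset.sum_comm]
    refine Finset.sum_congr rfl fun j _ => ?_
    rw [sum_apply]
    refine Finset.sum_congr rfl fun t _ => ?_
    rw [hadamardEntry_comm]
    rfl
  rw [h1]
  calc _ ≤ ∑ t ∈ Finset.range (2 ^ n), (M * ((2 : ℝ) ^ n) ^ (1 / r)) * (‖T‖ * C) := by
        refine (norm_sum_le _ _).trans (Finset.sum_le_sum fun t _ => ?_)
        refine (ContinuousLinearMap.le_opNorm _ _).trans ?_
        gcongr
        · exact hg n t
        · exact (T.le_opNorm _).trans (by gcongr; exact hz _)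
    _ = _ := by
      rw [Finset.sum_const, Finset.card_range, nsmul_eq_mul, Real.rpow_add (by positivity),
        Real.rpow_one]
      push_cast
      ring

/-- The signs square to 1, so all N² terms equal N^(-1/p'). -/
theorem norm_hadamardForm_eq {z : ℕ → X} {g : ℕ → StrongDual 𝕜 Y} {r r' : ℝ}
    (hrr' : r.HolderConjugate r') {T : X →L[𝕜] Y}
    (hT : ∀ i j, g i (T (z j)) = ((hadamardSumEntry r' i j : ℝ) : 𝕜)) (n : ℕ) :
    ‖hadamardForm z g n T‖ = ((2 : ℝ) ^ n) ^ (1 + 1 / r) := by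
  have h1 : hadamardForm z g n T =
      ((∑ t ∈ Finset.range (2 ^ n), ∑ j ∈ Finset.range (2 ^ n), (2 : ℝ) ^ (-(n : ℝ) / r') : ℝ) :
        𝕜) := by
    rw [RCLike.ofReal_sum]
    refine Finset.sum_congr rfl fun t ht => ?_
    rw [RCLike.ofReal_sum]
    refine Finset.sum_congr rfl fun j hj => ?_
    have ht' := Finset.mem_range.1 ht
    have hj' := Finset.mem_range.1 hj
    rw [hT, hadamardSumEntry_eq, blockIndex_block hj', hadamardSign_block n ht' hj',
      ← RCLike.ofReal_mul]
    congr 1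
    have h2 := abs_mul_abs_self (hadamardEntry n t j)
    rw [abs_hadamardEntry] at h2
    linear_combination -(2 : ℝ) ^ (-(n : ℝ) / r') * h2
  rw [h1, RCLike.norm_ofReal, abs_of_nonneg (by positivity)]
  simp only [Finset.sum_const, Finset.card_range, nsmul_eq_mul]
  push_cast
  have h2n : (0 : ℝ) < 2 ^ n := by positivity
  have h3 : (2 : ℝ) ^ (-(n : ℝ) / r') = ((2 : ℝ) ^ n) ^ (-1 / r') := by
    rw [← Real.rpow_natCast 2 n, ← Real.rpow_mul two_pos.le]
    congr 1; ring
  have h4 : (2 : ℝ) ^ n * (2 ^ n * ((2 : ℝ) ^ n) ^ (-1 / r')) = ((2 : ℝ) ^ n) ^ (1 + (1 + -1 / r')) := by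
    rw [Real.rpow_add h2n, Real.rpow_add h2n, Real.rpow_one]
  rw [h3, h4]
  congr 1
  have h5 := hrr'.inv_add_inv_eq_one
  rw [one_div, neg_div, one_div]
  linarith

end HadamardForm

/-! ### Test vectors in ℓ_p and extension of functionals -/

section HadamardVectors

variable {𝕜 : Type*} [RCLike 𝕜] {p : ℝ≥0∞} [Fact (1 ≤ p)]

theorem norm_sum_hadamardEntry_smul_single_le (hp : 0 < p.toReal) (n t : ℕ) :
    ‖∑ j ∈ Finset.range (2 ^ n), ((hadamardEntry n t j : ℝ) : 𝕜) •
      (lp.single p (2 ^ n - 1 + j) (1 : 𝕜) : Ell 𝕜 p)‖ ≤ ((2 : ℝ) ^ n) ^ (1 / p.toReal) := by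
  let c : ℕ → 𝕜 := fun i => ((hadamardEntry n t (i - (2 ^ n - 1)) : ℝ) : 𝕜)
  have h1 : ∑ j ∈ Finset.range (2 ^ n), ((hadamardEntry n t j : ℝ) : 𝕜) •
      (lp.single p (2 ^ n - 1 + j) (1 : 𝕜) : Ell 𝕜 p) =
      ∑ i ∈ (Finset.range (2 ^ n)).map (addLeftEmbedding (2 ^ n - 1)), lp.single p i (c i) := by
    rw [Finset.sum_map]
    refine Finset.sum_congr rfl fun j _ => ?_
    rw [addLeftEmbedding_apply, lp_single_eq_smul p _ (c _)]
    simp [c]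
  have h2 := lp.norm_sum_single hp c
    ((Finset.range (2 ^ n)).map (addLeftEmbedding (2 ^ n - 1)))
  rw [← h1] at h2
  have h3 : ∀ i, ‖c i‖ = 1 := fun i => by simp [c, abs_hadamardEntry]
  simp only [h3, Real.one_rpow, Finset.sum_const, Finset.card_map, Finset.card_range,
    nsmul_eq_mul, mul_one] at h2
  push_cast at h2
  rw [← h2, ← Real.rpow_mul (norm_nonneg _), mul_one_div_cancel hp.ne', Real.rpow_one]

/-- Transport f to the range of J by the inverse, of norm at most 1/c, and extend by Hahn–Banach. -/
theorem exists_extension_of_bounded_below {Z Y : Type*} [NormedAddCommGroup Z] [NormedSpace 𝕜 Z]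
    [NormedAddCommGroup Y] [NormedSpace 𝕜 Y] (J : Z →L[𝕜] Y) {c : ℝ} (hc : 0 < c)
    (hJ : ∀ x, c * ‖x‖ ≤ ‖J x‖) (f : StrongDual 𝕜 Z) :
    ∃ g : StrongDual 𝕜 Y, (∀ x, g (J x) = f x) ∧ ‖g‖ ≤ ‖f‖ / c := by
  have hinj : Function.Injective (J : Z →ₗ[𝕜] Y) := by
    refine (injective_iff_map_eq_zero _).2 fun x hx => ?_
    have := hJ x
    rw [show J x = 0 from hx, norm_zero] at this
    exact norm_le_zero_iff.1 (by nlinarith [norm_nonneg x])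
  let e := LinearEquiv.ofInjective (J : Z →ₗ[𝕜] Y) hinj
  let f' : StrongDual 𝕜 (LinearMap.range (J : Z →ₗ[𝕜] Y)) :=
    LinearMap.mkContinuous ((f : Z →ₗ[𝕜] 𝕜).comp (e.symm : _ →ₗ[𝕜] Z)) (‖f‖ / c) fun y => by
      obtain ⟨x, rfl⟩ := e.surjective y
      have h1 : ‖e x‖ = ‖J x‖ := rfl
      change ‖f (e.symm (e x))‖ ≤ _
      rw [e.symm_apply_apply, h1]
      calc ‖f x‖ ≤ ‖f‖ * ‖x‖ := f.le_opNorm x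
        _ = ‖f‖ / c * (c * ‖x‖) := by field_simp
        _ ≤ ‖f‖ / c * ‖J x‖ := by gcongr; exact hJ x
  obtain ⟨g, hg, hgn⟩ := exists_extension_norm_eq _ f'
  refine ⟨g, fun x => ?_, ?_⟩
  · have h1 := hg (e x)
    change g (J x) = f (e.symm (e x)) at h1
    rwa [e.symm_apply_apply] at h1
  · rw [hgn]
    exact LinearMap.mkContinuous_norm_le _ (by positivity) _

end HadamardVectors

/-! ### Embeddings of `ℓ_p` into `c₀` and into `ℓ_q` -/

section Embeddings

variable {𝕜 : Type*} [RCLike 𝕜] {p : ℝ≥0∞} [Fact (1 ≤ p)]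

/-- The formal inclusion `ℓ_p → ℓ_q` for `p ≤ q < ∞`. -/
noncomputable def lpInclusion {q : ℝ≥0∞} [Fact (1 ≤ q)] (hpq : p ≤ q) (hq : q ≠ ∞) :
    Ell 𝕜 p →L[𝕜] Ell 𝕜 q :=
  LinearMap.mkContinuous
    { toFun := fun x => ⟨(x : ℕ → 𝕜), (lp.memℓp x).of_exponent_ge hpq⟩
      map_add' := fun _ _ => rfl
      map_smul' := fun _ _ => rfl } 1
    (fun x => by
      have hp0 : 0 < p.toReal := ENNReal.toReal_pos (zero_lt_one.trans_le Fact.out).ne'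
        (ne_top_of_le_ne_top hq hpq)
      have hpq' : p.toReal ≤ q.toReal := ENNReal.toReal_mono hq hpq
      rw [one_mul]
      refine lp.norm_le_of_forall_sum_le (hp0.trans_le hpq') (norm_nonneg _) fun s => ?_
      change ∑ i ∈ s, ‖x i‖ ^ q.toReal ≤ _
      have h1 : ∀ y : ℝ, 0 ≤ y → y ^ q.toReal = y ^ p.toReal * y ^ (q.toReal - p.toReal) := by
        intro y hy
        rw [← Real.rpow_add_of_nonneg hy hp0.le (by linarith), add_sub_cancel]
      calc ∑ i ∈ s, ‖x i‖ ^ q.toReal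
          ≤ ∑ i ∈ s, ‖x i‖ ^ p.toReal * ‖x‖ ^ (q.toReal - p.toReal) := by
            refine Finset.sum_le_sum fun i _ => ?_
            rw [h1 _ (norm_nonneg _)]
            refine mul_le_mul_of_nonneg_left (Real.rpow_le_rpow (norm_nonneg _) ?_ (by linarith))
              (by positivity)
            exact lp.norm_apply_le_norm (zero_lt_one.trans_le (Fact.out : 1 ≤ p)).ne' x i
        _ ≤ ‖x‖ ^ p.toReal * ‖x‖ ^ (q.toReal - p.toReal) := by
            rw [← Finset.sum_mul]
            gcongr
            exact lp.sum_rpow_le_norm_rpow hp0 x s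
        _ = _ := (h1 _ (norm_nonneg _)).symm)

theorem tendsto_cocompact_zero_of_lp (hp : p ≠ ∞) (x : Ell 𝕜 p) :
    Filter.Tendsto (x : ℕ → 𝕜) (Filter.cocompact ℕ) (𝓝 0) := by
  have hp0 : 0 < p.toReal := ENNReal.toReal_pos (zero_lt_one.trans_le Fact.out).ne' hp
  rw [Filter.cocompact_eq_cofinite, tendsto_zero_iff_norm_tendsto_zero]
  have h1 := ((lp.memℓp x).summable hp0).tendsto_cofinite_zero
  have h2 := h1.rpow_const (p := 1 / p.toReal) (Or.inr (by positivity))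
  rw [Real.zero_rpow (by positivity)] at h2
  refine h2.congr fun i => ?_
  rw [← Real.rpow_mul (norm_nonneg _), mul_one_div_cancel hp0.ne', Real.rpow_one]

theorem czero_norm_apply_le (f : CZero 𝕜) (i : ℕ) : ‖f i‖ ≤ ‖f‖ :=
  f.toBCF.norm_coe_le_norm i

/-- The formal inclusion `ℓ_p → c₀` for `p < ∞`. -/
noncomputable def lpToCZero (hp : p ≠ ∞) : Ell 𝕜 p →L[𝕜] CZero 𝕜 :=
  LinearMap.mkContinuous
    { toFun := fun x => ⟨⟨(x : ℕ → 𝕜), continuous_of_discreteTopology⟩,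
        tendsto_cocompact_zero_of_lp hp x⟩
      map_add' := fun _ _ => rfl
      map_smul' := fun _ _ => rfl } 1
    (fun x => by
      rw [one_mul, ← ZeroAtInftyContinuousMap.norm_toBCF_eq_norm]
      refine (BoundedContinuousFunction.norm_le (norm_nonneg _)).2 fun i => ?_
      exact lp.norm_apply_le_norm (zero_lt_one.trans_le (Fact.out : 1 ≤ p)).ne' x i)

/-- The coordinate functionals on `c₀`. -/
noncomputable def czeroCoord (i : ℕ) : StrongDual 𝕜 (CZero 𝕜) :=
  LinearMap.mkContinuous
    { toFun := fun f => f i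
      map_add' := fun _ _ => rfl
      map_smul' := fun _ _ => rfl } 1
    (fun f => (czero_norm_apply_le f i).trans_eq (one_mul _).symm)

end Embeddings

/-! ### The main theorem -/

section Main

variable {𝕜 : Type*} [RCLike 𝕜] {p p' : ℝ≥0∞} [Fact (1 ≤ p)]
  {X : Type*} [NormedAddCommGroup X] [NormedSpace 𝕜 X]
  {Y : Type*} [NormedAddCommGroup Y] [NormedSpace 𝕜 Y]
  {Z : Type*} [NormedAddCommGroup Z] [NormedSpace 𝕜 Z]

theorem norm_sum_hadamardEntry_smul_apply_single_le (hp : 0 < p.toReal) (Q : Ell 𝕜 p →L[𝕜] X)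
    (n t : ℕ) :
    ‖∑ j ∈ Finset.range (2 ^ n), ((hadamardEntry n t j : ℝ) : 𝕜) •
      Q (lp.single p (2 ^ n - 1 + j) 1)‖ ≤ ‖Q‖ * ((2 : ℝ) ^ n) ^ (1 / p.toReal) := by
  simp_rw [← map_smul]
  rw [← map_sum]
  refine (Q.le_opNorm _).trans ?_
  gcongr
  exact norm_sum_hadamardEntry_smul_single_le hp n t

theorem norm_apply_single_le (Q : Ell 𝕜 p →L[𝕜] X) (j : ℕ) :
    ‖Q (lp.single p j 1)‖ ≤ ‖Q‖ := by
  refine (Q.le_opNorm _).trans_eq ?_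
  rw [lp.norm_single (zero_lt_one.trans_le Fact.out), norm_one, mul_one]

theorem notMem_closedSpanG2_of_apply_single (hpp' : p.toReal.HolderConjugate p'.toReal)
    (hp2 : p.toReal < 2) (T : X →L[𝕜] Y) (Q : Ell 𝕜 p →L[𝕜] X) (y : ℕ → StrongDual 𝕜 Y)
    {C : ℝ} (hy : ∀ i, ‖y i‖ ≤ C)
    (hT : ∀ i j, y i (T (Q (lp.single p j 1))) = ((hadamardSumEntry p'.toReal i j : ℝ) : 𝕜)) :
    T ∉ closedSpanG2 𝕜 X Y :=
  notMem_closedSpanG2 (z := fun j => Q (lp.single p j 1)) (g := y) (C := max ‖Q‖ C) hpp'.pos hp2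
    (fun j => (norm_apply_single_le Q j).trans (le_max_left _ _))
    (fun i => (hy i).trans (le_max_right _ _))
    (norm_hadamardForm_le_of_left hy
      (norm_sum_hadamardEntry_smul_apply_single_le hpp'.pos Q))
    (norm_hadamardForm_eq hpp' hT)

/-- Roles are exchanged: the functionals y i become the test vectors and the Q e_j, seen in the
bidual, the test functionals. Symmetry of the matrix leaves the entries unchanged. -/
theorem dualOp_notMem_closedSpanG2_of_apply_single (hpp' : p.toReal.HolderConjugate p'.toReal)
    (hp2 : p.toReal < 2) (T : X →L[𝕜] Y) (Q : Ell 𝕜 p →L[𝕜] X) (y : ℕ → StrongDual 𝕜 Y)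
    {C : ℝ} (hy : ∀ i, ‖y i‖ ≤ C)
    (hT : ∀ i j, y i (T (Q (lp.single p j 1))) = ((hadamardSumEntry p'.toReal i j : ℝ) : 𝕜)) :
    dualOp T ∉ closedSpanG2 𝕜 (StrongDual 𝕜 Y) (StrongDual 𝕜 X) := by
  let D := NormedSpace.inclusionInDoubleDual 𝕜 X
  refine notMem_closedSpanG2 (z := y) (g := fun j => D (Q (lp.single p j 1)))
    (C := max ‖Q‖ C) hpp'.pos hp2 (fun i => (hy i).trans (le_max_right _ _))
    (fun j => (NormedSpace.double_dual_bound 𝕜 X _).trans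
      ((norm_apply_single_le Q j).trans (le_max_left _ _)))
    (norm_hadamardForm_le_of_right (M := ‖Q‖) hy fun n t => ?_)
    (norm_hadamardForm_eq hpp' fun i j => ?_)
  · simp_rw [← map_smul D]
    rw [← map_sum]
    exact (NormedSpace.double_dual_bound 𝕜 X _).trans
      (norm_sum_hadamardEntry_smul_apply_single_le hpp'.pos Q n t)
  · rw [hadamardSumEntry_comm]
    exact hT j i

/-- T** extends T along the canonical embeddings, so by reflexivity of X it is dominated by T on its
whole domain. -/
theorem IsFSS.dualOp_isSSCS_of_isReflexiveSpace {T : X →L[𝕜] Y} (hT : IsFSS T)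
    (hX : IsReflexiveSpace 𝕜 X) : IsSSCS (dualOp T) := by
  refine IsFSS.isSSCS_of_dualOp ?_
  let e : X ≃ₗᵢ[𝕜] StrongDual 𝕜 (StrongDual 𝕜 X) :=
    LinearIsometryEquiv.ofSurjective (NormedSpace.inclusionInDoubleDualLi 𝕜) hX
  refine hT.of_norm_le _ (e.symm.toContinuousLinearEquiv : _ →L[𝕜] X) 1 fun ξ => ?_
  obtain ⟨x, rfl⟩ := e.surjective ξ
  have h1 : dualOp (dualOp T) (e x) = NormedSpace.inclusionInDoubleDual 𝕜 Y (T x) := rfl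
  have h2 : (e.symm.toContinuousLinearEquiv : _ →L[𝕜] X) (e x) = x := e.symm_apply_apply x
  rw [h1, h2, one_mul]
  exact NormedSpace.double_dual_bound 𝕜 Y (T x)

/-- Common form of both parts: of c₀ and ℓ_q one only uses a map ι from ℓ_p' and coordinate
functionals of norm at most 1 that recover the coordinates. -/
theorem hadamard_counterexample [Fact (1 ≤ p')] (hpp' : p.toReal.HolderConjugate p'.toReal)
    (hp2 : p.toReal < 2) (P : X →L[𝕜] Ell 𝕜 p) (Q : Ell 𝕜 p →L[𝕜] X)
    (hPQ : P.comp Q = ContinuousLinearMap.id 𝕜 (Ell 𝕜 p)) (ι : Ell 𝕜 p' →L[𝕜] Z)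
    (π : ℕ → StrongDual 𝕜 Z) (hπ : ∀ i, ‖π i‖ ≤ 1) (hπι : ∀ i x, π i (ι x) = x i)
    (J : Z →L[𝕜] Y) (hJ : ∃ c : ℝ, 0 < c ∧ ∀ x, c * ‖x‖ ≤ ‖J x‖) :
    (∃ U : Ell 𝕜 p →L[𝕜] Z,
      (∀ i j : ℕ, π i (U (lp.single p j (1 : 𝕜))) = ((hadamardSumEntry p'.toReal i j : ℝ) : 𝕜)) ∧
      IsFSS U ∧ IsSSCS U ∧ J.comp (U.comp P) ∉ closedSpanG2 𝕜 X Y) ∧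
    (IsReflexiveSpace 𝕜 X → ∃ V : StrongDual 𝕜 Y →L[𝕜] StrongDual 𝕜 X,
      IsFSS V ∧ IsSSCS V ∧ V ∉ closedSpanG2 𝕜 (StrongDual 𝕜 Y) (StrongDual 𝕜 X)) := by
  obtain ⟨c, hc, hJc⟩ := hJ
  choose y hyJ hyn using fun i => exists_extension_of_bounded_below J hc hJc (π i)
  have hyC : ∀ i, ‖y i‖ ≤ 1 / c := fun i => (hyn i).trans (by gcongr; exact hπ i)
  let H : Ell 𝕜 p →L[𝕜] Ell 𝕜 p' := hadamardOp hpp' hp2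
  have hH : IsFSS H := isFSS_hadamardOp hpp' hp2
  have hH' : IsFSS (dualOp H) := isFSS_dualOp_hadamardOp hpp' hp2
  have hentry : ∀ i j : ℕ, π i ((ι.comp H) (lp.single p j (1 : 𝕜))) =
      ((hadamardSumEntry p'.toReal i j : ℝ) : 𝕜) := fun i j =>
    (hπι i _).trans (hadamardOp_single hpp' hp2 i j)
  have hT : ∀ i j, y i (J.comp ((ι.comp H).comp P) (Q (lp.single p j 1))) =
      ((hadamardSumEntry p'.toReal i j : ℝ) : 𝕜) := by
    intro i j
    have h1 : P (Q (lp.single p j 1)) = lp.single p j 1 := DFunLike.congr_fun hPQ _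
    rw [ContinuousLinearMap.comp_apply, hyJ, ContinuousLinearMap.comp_apply, h1, hentry]
  have hFSS : IsFSS (J.comp ((ι.comp H).comp P)) := ((hH.comp_left ι).comp_right P).comp_left J
  refine ⟨⟨ι.comp H, hentry, hH.comp_left ι, IsFSS.isSSCS_of_dualOp (hH'.comp_right (dualOp ι)),
    notMem_closedSpanG2_of_apply_single hpp' hp2 _ Q y hyC hT⟩, fun hX =>
    ⟨dualOp (J.comp ((ι.comp H).comp P)), ?_, hFSS.dualOp_isSSCS_of_isReflexiveSpace hX,
      dualOp_notMem_closedSpanG2_of_apply_single hpp' hp2 _ Q y hyC hT⟩⟩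
  -- The adjoint factors as P* H* (Jι)*, with H* finitely strictly singular.
  exact (hH'.comp_right (dualOp (J.comp ι))).comp_left (dualOp P)

end Main

theorem holderConjugate_toReal {p p' : ℝ≥0∞} (hp1 : 1 < p) (hp : p ≠ ∞)
    (hpp' : p⁻¹ + p'⁻¹ = 1) : p.toReal.HolderConjugate p'.toReal := by
  have hp0 : p ≠ 0 := (zero_lt_one.trans hp1).ne'
  have hp'0 : p' ≠ 0 := by
    rintro rfl
    simp at hpp'
  rw [Real.holderConjugate_iff]
  refine ⟨?_, ?_⟩
  · rw [← ENNReal.toReal_one]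
    exact (ENNReal.toReal_lt_toReal (by norm_num) hp).2 hp1
  · rw [← ENNReal.toReal_inv, ← ENNReal.toReal_inv, ← ENNReal.toReal_add
      (ENNReal.inv_ne_top.2 hp0) (ENNReal.inv_ne_top.2 hp'0), hpp', ENNReal.toReal_one]

theorem theorem4p2 {𝕜 : Type*} [RCLike 𝕜]
    (p p' : ℝ≥0∞) [Fact (1 ≤ p)] (hp1 : 1 < p) (hp2 : p < 2) (hpp' : p⁻¹ + p'⁻¹ = 1)
    {X : Type*} [NormedAddCommGroup X] [NormedSpace 𝕜 X] [CompleteSpace X]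
    (P : X →L[𝕜] Ell 𝕜 p) (Q : Ell 𝕜 p →L[𝕜] X)
    (hPQ : P.comp Q = ContinuousLinearMap.id 𝕜 (Ell 𝕜 p))
    {Y : Type*} [NormedAddCommGroup Y] [NormedSpace 𝕜 Y] [CompleteSpace Y] :
    -- (i) copies of `c₀`
    (∀ J : CZero 𝕜 →L[𝕜] Y, (∃ c : ℝ, 0 < c ∧ ∀ x, c * ‖x‖ ≤ ‖J x‖) →
      (∃ U : Ell 𝕜 p →L[𝕜] CZero 𝕜,
        (∀ i j : ℕ, (U (lp.single p j (1 : 𝕜))) i = ((hadamardSumEntry p'.toReal i j : ℝ) : 𝕜)) ∧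
        IsFSS U ∧ IsSSCS U ∧
        J.comp (U.comp P) ∉ closedSpanG2 𝕜 X Y) ∧
      (IsReflexiveSpace 𝕜 X →
        ∃ V : StrongDual 𝕜 Y →L[𝕜] StrongDual 𝕜 X,
          IsFSS V ∧ IsSSCS V ∧
          V ∉ closedSpanG2 𝕜 (StrongDual 𝕜 Y) (StrongDual 𝕜 X))) ∧
    -- (ii) copies of `ℓ_q`, where `p' ≤ q < ∞`
    (∀ (q : ℝ≥0∞) [Fact (1 ≤ q)], p' ≤ q → q < ∞ →
      ∀ J : Ell 𝕜 q →L[𝕜] Y, (∃ c : ℝ, 0 < c ∧ ∀ x, c * ‖x‖ ≤ ‖J x‖) →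
      (∃ U : Ell 𝕜 p →L[𝕜] Ell 𝕜 q,
        (∀ i j : ℕ, (U (lp.single p j (1 : 𝕜))) i = ((hadamardSumEntry p'.toReal i j : ℝ) : 𝕜)) ∧
        IsFSS U ∧ IsSSCS U ∧
        J.comp (U.comp P) ∉ closedSpanG2 𝕜 X Y) ∧
      (IsReflexiveSpace 𝕜 X →
        ∃ V : StrongDual 𝕜 Y →L[𝕜] StrongDual 𝕜 X,
          IsFSS V ∧ IsSSCS V ∧
          V ∉ closedSpanG2 𝕜 (StrongDual 𝕜 Y) (StrongDual 𝕜 X))) := by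
  have hp : p ≠ ∞ := (hp2.trans (by norm_num)).ne
  have hconj := holderConjugate_toReal hp1 hp hpp'
  have hp2' : p.toReal < 2 := by
    have := (ENNReal.toReal_lt_toReal hp (by norm_num)).2 hp2
    simpa using this
  have hp'1 : 1 ≤ p' := ENNReal.inv_le_one.1 (hpp' ▸ le_add_self)
  have hp' : p' ≠ ∞ := by
    intro h
    have := hconj.symm.pos
    simp [h] at this
  have : Fact (1 ≤ p') := ⟨hp'1⟩
  refine ⟨fun J hJ => ?_, fun q _ hpq hq J hJ => ?_⟩
  · exact hadamard_counterexample hconj hp2' P Q hPQ (lpToCZero hp') czeroCoord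
      (fun i => LinearMap.mkContinuous_norm_le _ zero_le_one _)
      (fun i x => rfl) J hJ
  · refine hadamard_counterexample hconj hp2' P Q hPQ (lpInclusion hpq hq.ne)
      (fun i => lp.evalCLM 𝕜 (fun _ : ℕ => 𝕜) q i) (fun i => ?_) (fun i x => rfl) J hJ
    refine ContinuousLinearMap.opNorm_le_bound _ zero_le_one fun x => ?_
    rw [one_mul]
    exact lp.norm_apply_le_norm (zero_lt_one.trans_le (Fact.out : 1 ≤ q)).ne' x i
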